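/- **Setting.** Let $l,n\ge 0$ and $k\ge 1$. Let $\psi_r,\psi_r^\dagger$ ($r\in[l]=\{1,\dots,l\}$) be the annihilation and creation operators on the fermionic Fock space on $l$ modes. For $S=\{s_1<\dots<s_m\}\subset[l]$ put $\Psi_S=\psi_{s_1}\cdots\psi_{s_m}$, $\Psi_S^\dagger=\psi_{s_m}^\dagger\cdots\psi_{s_1}^\dagger$ and $|S\rangle=\Psi_S^\dagger|\varnothing\rangle$. For disjoint sets $A,B$ let $\sigma(A,B)$ be the sign of the permutation that sorts the concatenation of the increasing sequences $A$ and $B$. Let $\Omega=\sum_r\psi_r\otimes\psi_r^\dagger$, and let $\mathcal G_k$ be the set of $n$-particle vectors $|v\rangle=\sum_{|S|=n}v(S)|S\rangle$ with $\Omega^k|v\rangle\otimes|v\rangle=0$. Let $G\subset[l]$, $|G|=n$. For $v(G)\neq0$, $P\subset G$, $Q\subset[l]\setminus G$, $|P|=|Q|$, put $$a_{P,Q}=\sigma(G\setminus P,Q)\,\frac{v(G\cup Q\setminus P)}{v(G)}$$ (the sign is $1$ if $G=\{1,\dots,n\}$), and for $|P|=|Q|\ge1$ define the connected amplitudes $$v^{(c)}_{P,Q}=a_{P,Q}-\sum_{\substack{P'\subsetneq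 P,\ Q'\subsetneq Q\\ |P'|=|Q'|}}a_{P',Q'}\,a_{P\setminus P',Q\setminus Q'}\,(-1)^{|P\setminus P'|+1}\frac{|P'|}{|P|}\,\sigma(P\setminus P',P')\,\sigma(Q',Q\setminus Q').$$ For complex parameters $\theta=(\theta_{P,Q})$, indexed by the pairs with $P\subset G$, $Q\subset[l]\setminus G$, $1\le|P|=|Q|\le k$, let $$T_{k'}=\sum_{|P|=|Q|=k'}\theta_{P,Q}\,\Psi_Q^\dagger\Psi_P\qquad(1\le k'\le k).$$ Let $$F(x_1,\dots,x_k)=\sqrt{1+2(x_2+x_4+\cdots)}\;\exp\left(\int_0^1\frac{x_1+3x_3\mu^2+5x_5\mu^4+\cdots}{1+2(x_2\mu^2+x_4\mu^4+\cdots)}\,d\mu\right),$$ where $x_j=0$ for $j>k$ and the square root is the principal one. For $\mathbf m\in\mathbb N^k$ write $|\mathbf m|=\sum_j m_j$ and $\mathbf k\cdot\mathbf m=\sum_j j\,m_j$, and define $\nu(\mathbf m)=1$ if $|\mathbf m|\le1$, and otherwise recursively $$\nu(\mathbf m)=\sum_{\substack{\mathbf m'\le\mathbf m\\ \mathbf m'\ne\mathbf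 0,\,\mathbf m}}(-1)^{\mathbf k\cdot(\mathbf m-\mathbf m')+1}\,\frac{\mathbf k\cdot\mathbf m'}{\mathbf k\cdot\mathbf m}\,\nu(\mathbf m')\,\nu(\mathbf m-\mathbf m')\prod_j\binom{m_j}{m'_j}.$$ For commuting nilpotent operators, $F(T_1,\dots,T_k)$ denotes their substitution into the Taylor series of $F$ at the origin. **Theorem.** 1. $F$ is the generating function of $\nu$: for all $x$ in a neighbourhood of $0\in\mathbb C^k$, $$F(x_1,\dots,x_k)=\sum_{\mathbf m\in\mathbb N^k}\frac{\nu(\mathbf m)}{m_1!\cdots m_k!}\,x_1^{m_1}\cdots x_k^{m_k}.$$ 2. For every $G\subset[l]$ and all parameters $\theta$, the operators $T_1,\dots,T_k$ commute with one another and are nilpotent. 3. If $|v\rangle\in\mathcal G_k$ and $v(G)\ne0$, then $$|v\rangle=v(G)\,F(T_1,\dots,T_k)|G\rangle\qquad\text{with}\qquad\theta_{P,Q}=v^{(c)}_{P,Q}\,\sigma(G\setminus P,P).$$ 4. Consequently every nonzero $|v\rangle\in\mathcal G_k$ has the form $v(G)\,F(T_1,\dots,T_k)|G\rangle$ for some $G$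 with $|G|=n$, $v(G)\neq0$, and some $\theta$. The number of parameters $\theta_{P,Q}$ is $\sum_{j=1}^k\binom nj\binom{l-n}j\le k\,n^k(l-n)^k$. -/

import Mathlib

namespace Fermion

/-- Vectors of the fermionic Fock space on `l` modes, given by their amplitudes `v S` in the
occupation basis; the basis vectors are indexed by the sets `S` of occupied modes. -/
abbrev Fock (l : ℕ) : Type := Finset (Fin l) → ℂ

/-- The basis state `|S⟩ = ψ†_{s_m} ⋯ ψ†_{s_1} |∅⟩`, where `S = {s_1 < ⋯ < s_m}`
(see `ket_eq_creMonomial`). -/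
def ket {l : ℕ} (S : Finset (Fin l)) : Fock l := Pi.single S 1

/-- `σ(A, B)`: the sign of the permutation that sorts the concatenation of the increasing
sequences `A` and `B`, that is, `-1` to the number of inversions. -/
def sgn {l : ℕ} (A B : Finset (Fin l)) : ℂ :=
  (-1) ^ ((A ×ˢ B).filter (fun p => p.2 < p.1)).card

/-- The creation operator `ψ†_r`: it maps `|S⟩` to `σ(S, {r}) |S ∪ {r}⟩` if `r ∉ S`,
and to `0` if `r ∈ S`. -/
def cre {l : ℕ} (r : Fin l) : Module.End ℂ (Fock l) where
  toFun v S := if r ∈ S then sgn (S.erase r) {r} * v (S.erase r) else 0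
  map_add' v w := by
    funext S
    by_cases h : r ∈ S <;> simp [h, mul_add]
  map_smul' c v := by
    funext S
    by_cases h : r ∈ S <;> simp [h, mul_left_comm]

/-- The annihilation operator `ψ_r`: it maps `|S⟩` to `σ(S ∖ {r}, {r}) |S ∖ {r}⟩` if `r ∈ S`,
and to `0` if `r ∉ S`. -/
def ann {l : ℕ} (r : Fin l) : Module.End ℂ (Fock l) where
  toFun v S := if r ∈ S then 0 else sgn S {r} * v (insert r S)
  map_add' v w := by
    funext S
    by_cases h : r ∈ S <;> simp [h, mul_add]
  map_smul' c v := by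
    funext S
    by_cases h : r ∈ S <;> simp [h, mul_left_comm]

/-- `Ψ_S = ψ_{s_1} ⋯ ψ_{s_m}` for `S = {s_1 < ⋯ < s_m}`. -/
def annMonomial {l : ℕ} (S : Finset (Fin l)) : Module.End ℂ (Fock l) :=
  ((S.sort (· ≤ ·)).map ann).prod

/-- `Ψ†_S = ψ†_{s_m} ⋯ ψ†_{s_1}` for `S = {s_1 < ⋯ < s_m}`. -/
def creMonomial {l : ℕ} (S : Finset (Fin l)) : Module.End ℂ (Fock l) :=
  ((S.sort (· ≤ ·)).reverse.map cre).prod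

/-- The operator `Ω = ∑_r ψ_r ⊗ ψ†_r`. -/
noncomputable def Omega (l : ℕ) :
    Module.End ℂ (TensorProduct ℂ (Fock l) (Fock l)) :=
  ∑ r : Fin l, TensorProduct.map (ann r) (cre r)

/-- The set `𝒢_k` of `n`-particle states on `l` modes with `Ω^k (|v⟩ ⊗ |v⟩) = 0`. -/
def pluckerStates (l n k : ℕ) : Set (Fock l) :=
  {v | (∀ S : Finset (Fin l), S.card ≠ n → v S = 0) ∧
    (Omega l ^ k) (TensorProduct.tmul ℂ v v) = 0}

/-- The relative amplitude `v(G ∪ Q ∖ P) / v(G)` of the excitation `P → Q` of the reference `G`.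
The sign `σ(G ∖ P, Q)` accounts for a reference `G` in general position; it is `1` when `G`
consists of the first modes (see `relAmp_of_lt`). -/
noncomputable def relAmp {l : ℕ} (G : Finset (Fin l)) (v : Fock l) (P Q : Finset (Fin l)) : ℂ :=
  sgn (G \ P) Q * (v ((G \ P) ∪ Q) / v G)

/-- The connected amplitudes `v^{(c)}_{P,Q}`. -/
noncomputable def connAmp {l : ℕ} (G : Finset (Fin l)) (v : Fock l) (P Q : Finset (Fin l)) : ℂ :=
  relAmp G v P Q -
    ∑ P' ∈ P.ssubsets, ∑ Q' ∈ Q.ssubsets.filter (fun Q' => Q'.card = P'.card),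
      relAmp G v P' Q' * relAmp G v (P \ P') (Q \ Q') *
        ((-1) ^ ((P \ P').card + 1) * ((P'.card : ℂ) / (P.card : ℂ)) *
          sgn (P \ P') P' * sgn Q' (Q \ Q'))

/-- The pairs `(P, Q)` with `P ⊆ G`, `Q ⊆ [l] ∖ G` and `1 ≤ |P| = |Q| ≤ k`. They index the
parameters `θ_{P,Q}` of the ansatz. -/
abbrev Excitation {l : ℕ} (G : Finset (Fin l)) (k : ℕ) : Type :=
  {e : Finset (Fin l) × Finset (Fin l) //
    e.1 ⊆ G ∧ e.2 ⊆ Gᶜ ∧ e.1.card = e.2.card ∧ 1 ≤ e.1.card ∧ e.1.card ≤ k}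

/-- The parameters `θ_{P,Q} = v^{(c)}_{P,Q} σ(G ∖ P, P)` of a state `v`. -/
noncomputable def theta {l : ℕ} (G : Finset (Fin l)) (k : ℕ) (v : Fock l) (e : Excitation G k) :
    ℂ :=
  connAmp G v e.1.1 e.1.2 * sgn (G \ e.1.1) e.1.1

/-- The excitation operators `T_1, …, T_k` with parameters `θ`; the index `i : Fin k` stands for
`k' = i + 1`, and `T_{k'} = ∑_{|P| = |Q| = k'} θ_{P,Q} Ψ†_Q Ψ_P`. -/
noncomputable def excOp {l k : ℕ} (G : Finset (Fin l)) (θ : Excitation G k → ℂ) (i : Fin k) :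
    Module.End ℂ (Fock l) :=
  ∑ e ∈ Finset.univ.filter (fun e : Excitation G k => e.1.1.card = (i : ℕ) + 1),
    θ e • (creMonomial e.1.2 * annMonomial e.1.1)

/-- The function
`F(x_1, …, x_k) = √(1 + 2(x_2 + x_4 + ⋯)) *
  exp (∫_0^1 (x_1 + 3 x_3 μ² + ⋯) / (1 + 2 (x_2 μ² + x_4 μ⁴ + ⋯)) dμ)`,
with the principal branch of the square root; `x i` stands for `x_{i+1}`. -/
noncomputable def ansatzF (k : ℕ) (x : Fin k → ℂ) : ℂ :=
  (1 + 2 * ∑ i ∈ Finset.univ.filter (fun i : Fin k => Even ((i : ℕ) + 1)), x i) ^ (1 / 2 : ℂ) *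
    Complex.exp (∫ μ in (0 : ℝ)..1,
      (∑ i ∈ Finset.univ.filter (fun i : Fin k => Odd ((i : ℕ) + 1)),
          (((i : ℕ) + 1 : ℕ) : ℂ) * x i * (μ : ℂ) ^ (i : ℕ)) /
        (1 + 2 * ∑ i ∈ Finset.univ.filter (fun i : Fin k => Even ((i : ℕ) + 1)),
          x i * (μ : ℂ) ^ ((i : ℕ) + 1)))

/-- `𝐤 · 𝐦 = ∑_{k'} k' m_{k'}`, where `m i` stands for `m_{i+1}`. -/
def weight {k : ℕ} (m : Fin k → ℕ) : ℕ := ∑ i : Fin k, ((i : ℕ) + 1) * m i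

/-- The coefficients `ν(𝐦)`: `ν(𝐦) = 1` if `|𝐦| ≤ 1`, and otherwise
`ν(𝐦) = ∑_{𝐦' < 𝐦} (-1)^{𝐤·(𝐦-𝐦')+1} (𝐤·𝐦' / 𝐤·𝐦) ν(𝐦') ν(𝐦-𝐦') ∏ᵢ (mᵢ choose m'ᵢ)`.
The sum is over the open interval `0 < 𝐦' < 𝐦`, since the factor `𝐤·𝐦'` kills the term
`𝐦' = 0`. -/
def nu {k : ℕ} (m : Fin k → ℕ) : ℚ :=
  if ∑ i, m i ≤ 1 then 1
  else ∑ m' ∈ (Finset.Ioo 0 m).attach,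
    (-1) ^ (weight (m - m'.1) + 1) * ((weight m'.1 : ℚ) / (weight m : ℚ)) *
      nu m'.1 * nu (m - m'.1) * ∏ i, ((m i).choose (m'.1 i) : ℚ)
termination_by ∑ i, m i
decreasing_by
  · have h := Finset.mem_Ioo.1 m'.2
    obtain ⟨hle, j, hj⟩ := Pi.lt_def.1 h.2
    exact Finset.sum_lt_sum (fun i _ => hle i) ⟨j, Finset.mem_univ _, hj⟩
  · have h := Finset.mem_Ioo.1 m'.2
    obtain ⟨_, j, hj⟩ := Pi.lt_def.1 h.1
    have hle := h.2.le
    refine Finset.sum_lt_sum (fun i _ => Nat.sub_le _ _) ⟨j, Finset.mem_univ _, ?_⟩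
    exact Nat.sub_lt (lt_of_lt_of_le hj (hle j)) hj

/-- The partial derivative `∂f/∂x_i`. -/
noncomputable def partialDeriv {k : ℕ} (i : Fin k) (f : (Fin k → ℂ) → ℂ) (x : Fin k → ℂ) : ℂ :=
  deriv (fun t => f (Function.update x i t)) (x i)

/-- The Taylor coefficient `(∂_1^{m_1} ⋯ ∂_k^{m_k} f)(0) / (m_1! ⋯ m_k!)` of `f` at the origin. -/
noncomputable def taylorCoeff {k : ℕ} (f : (Fin k → ℂ) → ℂ) (m : Fin k → ℕ) : ℂ :=
  ((List.finRange k).foldr (fun i g => (partialDeriv i)^[m i] g) f) 0 /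
    ∏ i, ((m i).factorial : ℂ)

/-- The value `f(T_1, …, T_k)` of an analytic function at commuting nilpotent operators: these are
substituted into the Taylor series of `f` at the origin, which then has finitely many nonzero
terms. -/
noncomputable def opEval {k : ℕ} {V : Type*} [AddCommGroup V] [Module ℂ V]
    (f : (Fin k → ℂ) → ℂ) (T : Fin k → Module.End ℂ V) : Module.End ℂ V :=
  ∑ᶠ m : Fin k → ℕ, taylorCoeff f m • (List.ofFn fun i => T i ^ m i).prod

theorem sgn_of_lt {l : ℕ} {A B : Finset (Fin l)} (h : ∀ a ∈ A, ∀ b ∈ B, a < b) :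
    sgn A B = 1 := by
  unfold sgn
  rw [Finset.card_eq_zero.2, pow_zero]
  refine Finset.filter_eq_empty_iff.2 ?_
  intro p hp
  rw [Finset.mem_product] at hp
  exact not_lt.2 (h _ hp.1 _ hp.2).le

theorem relAmp_of_lt {l : ℕ} {G P Q : Finset (Fin l)} (v : Fock l)
    (h : ∀ a ∈ G, ∀ b ∈ Q, a < b) :
    relAmp G v P Q = v ((G \ P) ∪ Q) / v G := by
  unfold relAmp
  rw [sgn_of_lt, one_mul]
  exact fun a ha b hb => h a (Finset.mem_sdiff.1 ha).1 b hb

theorem cre_ket {l : ℕ} {r : Fin l} {S : Finset (Fin l)} (h : r ∉ S) :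
    cre r (ket S) = sgn S {r} • ket (insert r S) := by
  funext U
  by_cases hU : U = insert r S
  · subst hU
    simp [cre, ket, h]
  · by_cases hr : r ∈ U
    · have : U.erase r ≠ S := by
        rintro rfl
        exact hU (Finset.insert_erase hr).symm
      simp [cre, ket, hU, this]
    · simp [cre, ket, hU, hr]

theorem ket_eq_creMonomial {l : ℕ} (S : Finset (Fin l)) : ket S = creMonomial S (ket ∅) := by
  induction S using Finset.induction_on_max with
  | empty => simp [creMonomial]
  | insert a s hs ih =>
    have ha : a ∉ s := fun h => lt_irrefl _ (hs a h)
    have hsort : (insert a s).sort (· ≤ ·) = s.sort (· ≤ ·) ++ [a] := by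
      refine List.Perm.eq_of_pairwise (le := (· ≤ ·)) (fun x y _ _ h1 h2 => le_antisymm h1 h2)
        (Finset.pairwise_sort _ _) ?_ ?_
      · refine List.pairwise_append.2 ⟨Finset.pairwise_sort _ _, by simp, ?_⟩
        intro x hx y hy
        rw [List.mem_singleton.1 hy]
        exact (hs x ((Finset.mem_sort _).1 hx)).le
      · refine (List.perm_ext_iff_of_nodup (Finset.sort_nodup _ _) ?_).2 ?_
        · refine List.nodup_append.2 ⟨Finset.sort_nodup _ _, by simp, ?_⟩
          rintro x hx y hy rfl
          exact ha (List.mem_singleton.1 hy ▸ (Finset.mem_sort _).1 hx)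
        · intro x
          simp [or_comm]
    have : creMonomial (insert a s) = cre a * creMonomial s := by
      simp [creMonomial, hsort]
    rw [this, Module.End.mul_apply, ← ih, cre_ket ha, sgn_of_lt, one_smul]
    intro x hx b hb
    rw [Finset.mem_singleton.1 hb]
    exact hs x hx

end Fermion

open Fermion

namespace Fermion

open Finset

/-! ### Sorting signs under union and exchange. -/

section Signs

variable {l : ℕ}

/-! Fix `G` with `v G ≠ 0`. The excitations `E_{P,Q}` of `G`, normalised by the sign σ(G ∖ P, P),
commute, and the product of two of them is zero or ± another one. Sorting by excitation order, |v⟩ =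
v(G) ∑_N A_N |G⟩ with A_N = ∑_{|P|=|Q|=N} a_{P,Q} E_{P,Q}. With A(μ) = ∑ A_N μ^N, the definition of
the connected amplitudes says exactly A'(μ) A(-μ) = ∑_j j T_j μ^{j-1}, where T_j collects the
connected amplitudes of order j (`ampOp_recursion`).

Membership in 𝒢_k enters once: it forces T_j = 0 for j > k (`connAmp_eq_zero`). Indeed |P|
v^{(c)}_{P,Q} is a sum of products a_{A,E} a_{P∖A,Q∖E} weighted by |A| = |E|. Writing |E| as a count
of the q ∈ E splits it into one sum for each q ∈ Q, and each of these is a quadratic Plücker-type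
relation given by Ω^{|P|-1}.

The recursion for ν is the same equation with scalars x_j in place of T_j
(`sum_antidiagonal_coeffF`). Together with A_0 = 1 the equation determines A, so A_N = ∑_{𝐤·𝐦=N}
ν(𝐦)/𝐦! T^𝐦 (`eq_sum_coeffF_of_recursion`).

It remains to solve the scalar equation. A majorant argument gives convergence. With E(μ) = x_2 μ² +
x_4 μ⁴ + ⋯ and O(μ) = x_1 + 3 x_3 μ² + ⋯ one has A'(μ) A(-μ) = O + E', whose even and odd parts in μ
are O and E'. Hence (A(μ) A(-μ))' = 2E', so A(μ) A(-μ) = 1 + 2E, and A'/A = (O + E')/(1 + 2E).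
Integrating from 0 to 1 gives F (`seriesF_one_eq_ansatzF`). -/

theorem sgn_union_left {A B : Finset (Fin l)} (C : Finset (Fin l)) (h : Disjoint A B) :
    sgn (A ∪ B) C = sgn A C * sgn B C := by
  unfold sgn
  rw [← pow_add, union_product, filter_union, card_union_of_disjoint]
  exact disjoint_filter_filter (disjoint_product.2 (Or.inl h))

theorem sgn_union_right (A : Finset (Fin l)) {B C : Finset (Fin l)} (h : Disjoint B C) :
    sgn A (B ∪ C) = sgn A B * sgn A C := by
  unfold sgn
  rw [← pow_add, product_union, filter_union, card_union_of_disjoint]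
  exact disjoint_filter_filter (disjoint_product.2 (Or.inr h))

@[simp] theorem sgn_empty_left (A : Finset (Fin l)) : sgn ∅ A = 1 := by simp [sgn]

@[simp] theorem sgn_empty_right (A : Finset (Fin l)) : sgn A ∅ = 1 := by simp [sgn]

@[simp] theorem sgn_mul_self (A B : Finset (Fin l)) : sgn A B * sgn A B = 1 := by
  unfold sgn
  rw [← mul_pow]
  simp

theorem sgn_ne_zero (A B : Finset (Fin l)) : sgn A B ≠ 0 := fun h => by
  simpa [h] using sgn_mul_self A B

/-- By disjointness every pair in `A ×ˢ B` is inverted in exactly one of the two concatenations. -/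
theorem sgn_mul_sgn_swap {A B : Finset (Fin l)} (h : Disjoint A B) :
    sgn A B * sgn B A = (-1) ^ (A.card * B.card) := by
  unfold sgn
  have hBA : ((B ×ˢ A).filter (fun p => p.2 < p.1)).card =
      ((A ×ˢ B).filter (fun p => ¬ p.2 < p.1)).card := by
    refine card_bij' (fun p _ => p.swap) (fun p _ => p.swap) ?_ ?_ (by simp) (by simp)
    · rintro ⟨x, y⟩ hp
      simp only [mem_filter, mem_product, Prod.swap_prod_mk, not_lt] at hp ⊢
      exact ⟨hp.1.symm, hp.2.le⟩
    · rintro ⟨x, y⟩ hp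
      simp only [mem_filter, mem_product, Prod.swap_prod_mk, not_lt] at hp ⊢
      exact ⟨hp.1.symm, lt_of_le_of_ne hp.2 (disjoint_left.1 h hp.1.1 <| · ▸ hp.1.2)⟩
  rw [← pow_add, hBA, card_filter_add_card_filter_not, card_product]

theorem sgn_swap {A B : Finset (Fin l)} (h : Disjoint A B) :
    sgn A B = (-1) ^ (A.card * B.card) * sgn B A := by
  rw [← sgn_mul_sgn_swap h, mul_assoc, sgn_mul_self, mul_one]

end Signs

/-! ### Normalised excitations of a reference and their products. -/

section Monomials

variable {l : ℕ}

theorem sort_insert_of_lt {a : Fin l} {s : Finset (Fin l)} (h : ∀ x ∈ s, a < x) :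
    (insert a s).sort (· ≤ ·) = a :: s.sort (· ≤ ·) :=
  sort_insert (r := (· ≤ ·)) (fun x hx => (h x hx).le) fun ha => lt_irrefl _ (h a ha)

theorem sort_insert_of_gt {a : Fin l} {s : Finset (Fin l)} (hs : ∀ x ∈ s, x < a) :
    (insert a s).sort (· ≤ ·) = s.sort (· ≤ ·) ++ [a] := by
  have ha : a ∉ s := fun h => lt_irrefl _ (hs a h)
  refine List.Perm.eq_of_pairwise (le := (· ≤ ·)) (fun x y _ _ h1 h2 => le_antisymm h1 h2)
    (pairwise_sort _ _) ?_ ?_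
  · refine List.pairwise_append.2 ⟨pairwise_sort _ _, by simp, ?_⟩
    intro x hx y hy
    rw [List.mem_singleton.1 hy]
    exact (hs x ((mem_sort _).1 hx)).le
  · refine (List.perm_ext_iff_of_nodup (sort_nodup _ _) ?_).2 ?_
    · refine List.nodup_append.2 ⟨sort_nodup _ _, by simp, ?_⟩
      rintro x hx y hy rfl
      exact ha (List.mem_singleton.1 hy ▸ (mem_sort _).1 hx)
    · intro x
      simp [or_comm]

/-- The smallest mode of `P` is the leftmost factor; peeling it off produces no sign against the
rest of `P`, hence induction on the minimum. For creation operators the order is reversed and the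
maximum plays this role. -/
theorem annMonomial_apply (P : Finset (Fin l)) (v : Fock l) (S : Finset (Fin l)) :
    annMonomial P v S = if Disjoint S P then sgn S P * v (S ∪ P) else 0 := by
  induction P using Finset.induction_on_min generalizing S with
  | empty => simp [annMonomial]
  | insert a s hs ih =>
    have ha : a ∉ s := fun h => lt_irrefl _ (hs a h)
    have hmul : annMonomial (insert a s) = ann a * annMonomial s := by
      simp [annMonomial, sort_insert_of_lt hs]
    rw [hmul, Module.End.mul_apply]
    by_cases haS : a ∈ S
    · simp [ann, haS]
    · have hsa : sgn {a} s = 1 := sgn_of_lt fun x hx y hy => by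
        rw [mem_singleton.1 hx]; exact hs y hy
      have hun : insert a S ∪ s = S ∪ insert a s := by
        ext; simp
      have hd : Disjoint (insert a S) s ↔ Disjoint S (insert a s) := by
        simp [ha, haS]
      simp only [ann, LinearMap.coe_mk, AddHom.coe_mk, if_neg haS, ih, hd, hun]
      split_ifs with hdis
      · rw [insert_eq a S, sgn_union_left s (by simpa using haS), hsa, insert_eq a s,
          sgn_union_right S (by simpa using ha)]
        ring
      · simp

theorem creMonomial_apply (Q : Finset (Fin l)) (v : Fock l) (S : Finset (Fin l)) :
    creMonomial Q v S = if Q ⊆ S then sgn (S \ Q) Q * v (S \ Q) else 0 := by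
  induction Q using Finset.induction_on_max generalizing S with
  | empty => simp [creMonomial]
  | insert a s hs ih =>
    have ha : a ∉ s := fun h => lt_irrefl _ (hs a h)
    have hmul : creMonomial (insert a s) = cre a * creMonomial s := by
      simp [creMonomial, sort_insert_of_gt hs]
    rw [hmul, Module.End.mul_apply]
    by_cases haS : a ∈ S
    · have hsa : sgn s {a} = 1 := sgn_of_lt fun x hx y hy => by
        rw [mem_singleton.1 hy]; exact hs x hx
      have hsub : s ⊆ S.erase a ↔ insert a s ⊆ S := by
        rw [insert_subset_iff, subset_erase]
        tauto
      have hdiff : S.erase a \ s = S \ insert a s := by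
        ext; simp; tauto
      simp only [cre, LinearMap.coe_mk, AddHom.coe_mk, if_pos haS, ih, hsub, hdiff]
      split_ifs with h
      · have hS : S.erase a = (S \ insert a s) ∪ s := by
          rw [← hdiff, sdiff_union_of_subset (hsub.2 h)]
        have hd : Disjoint (S \ insert a s) s :=
          disjoint_sdiff_self_left.mono_right (subset_insert _ _)
        rw [hS, sgn_union_left _ hd, hsa, insert_eq a s,
          sgn_union_right _ (by simpa using ha)]
        ring
      · simp
    · have : ¬ insert a s ⊆ S := fun h => haS (h (mem_insert_self _ _))
      simp [cre, haS, this]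

/-- The excitation `P → Q` of the reference `G`, normalised so that it maps `|G⟩` to
`σ(G ∖ P, Q) |G ∖ P ∪ Q⟩`. -/
noncomputable def excite (G P Q : Finset (Fin l)) : Module.End ℂ (Fock l) :=
  sgn (G \ P) P • (creMonomial Q * annMonomial P)

theorem excite_apply {G P Q : Finset (Fin l)} (hPQ : Disjoint P Q) (v : Fock l)
    (S : Finset (Fin l)) :
    excite G P Q v S = if Q ⊆ S ∧ Disjoint S P then
      sgn (G \ P) P * (sgn (S \ Q) Q * (sgn (S \ Q) P * v ((S \ Q) ∪ P))) else 0 := by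
  simp only [excite, LinearMap.smul_apply, Pi.smul_apply, Module.End.mul_apply,
    creMonomial_apply, annMonomial_apply, smul_eq_mul]
  by_cases hQ : Q ⊆ S
  · have : Disjoint (S \ Q) P ↔ Disjoint S P := by
      refine ⟨fun h => ?_, fun h => h.mono_left sdiff_subset⟩
      rw [← sdiff_union_of_subset hQ, disjoint_union_left]
      exact ⟨h, hPQ.symm⟩
    simp [hQ, this]
  · simp [hQ]

theorem excite_ket {G P Q : Finset (Fin l)} (hP : P ⊆ G) (hQ : Disjoint G Q) :
    excite G P Q (ket G) = sgn (G \ P) Q • ket (G \ P ∪ Q) := by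
  funext S
  rw [excite_apply (hQ.mono_left hP)]
  by_cases hS : S = G \ P ∪ Q
  · subst hS
    have h1 : (G \ P ∪ Q) \ Q = G \ P := by
      rw [union_sdiff_right]
      exact sdiff_eq_self_of_disjoint (hQ.mono_left sdiff_subset)
    have h2 : Disjoint (G \ P ∪ Q) P :=
      disjoint_union_left.2 ⟨disjoint_sdiff_self_left, (hQ.mono_left hP).symm⟩
    rw [if_pos ⟨subset_union_right, h2⟩, h1, sdiff_union_of_subset hP]
    simp only [ket, Pi.single_eq_same, Pi.smul_apply, smul_eq_mul]
    linear_combination sgn (G \ P) Q * sgn_mul_self (G \ P) P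
  · rw [Pi.smul_apply, ket, ket, Pi.single_eq_of_ne hS, smul_zero]
    split_ifs with h
    · rw [Pi.single_eq_of_ne, mul_zero, mul_zero, mul_zero]
      rintro hG
      apply hS
      rw [← hG, union_sdiff_right, sdiff_eq_self_of_disjoint (h.2.mono_left sdiff_subset),
        sdiff_union_of_subset h.1]
    · rfl

/-- The product of two excitations of the same reference. -/
theorem excite_mul {G P Q P' Q' : Finset (Fin l)} (hP : P ⊆ G) (hP' : P' ⊆ G)
    (hQ : Disjoint G Q) (hQ' : Disjoint G Q') (hc : P.card = Q.card) (hc' : P'.card = Q'.card) :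
    excite G P Q * excite G P' Q' =
      if Disjoint P P' ∧ Disjoint Q Q' then
        (sgn P' P * sgn Q Q') • excite G (P ∪ P') (Q ∪ Q') else 0 := by
  have hPQ := hQ.mono_left hP
  have hPQ' := hQ'.mono_left hP
  have hP'Q := hQ.mono_left hP'
  have hP'Q' := hQ'.mono_left hP'
  ext v S
  -- `ext` reduces equality of operators to basis vectors. Only linearity was needed for this, so
  -- the basis vector is replaced by an arbitrary `w`.
  have hlin : ∀ f : Module.End ℂ (Fock l), (f ∘ₗ LinearMap.single ℂ (fun _ => ℂ) v) 1 = f (ket v) :=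
    fun f => rfl
  rw [hlin, hlin]
  generalize ket v = w
  rw [Module.End.mul_apply, excite_apply hPQ, excite_apply hP'Q']
  have hrhs : (if Disjoint P P' ∧ Disjoint Q Q' then
      (sgn P' P * sgn Q Q') • excite G (P ∪ P') (Q ∪ Q') else 0) w S =
      if Disjoint P P' ∧ Disjoint Q Q' then
      (sgn P' P * sgn Q Q') * excite G (P ∪ P') (Q ∪ Q') w S else 0 := by
    split_ifs <;> simp
  rw [hrhs, excite_apply (by simp only [disjoint_union_left, disjoint_union_right]; tauto)]
  by_cases hd : Disjoint P P' ∧ Disjoint Q Q'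
  · obtain ⟨hPP, hQQ⟩ := hd
    rw [if_pos (⟨hPP, hQQ⟩ : Disjoint P P' ∧ Disjoint Q Q')]
    by_cases h : Q ∪ Q' ⊆ S ∧ Disjoint S (P ∪ P')
    · have hQS := union_subset_left h.1
      have hQS' := union_subset_right h.1
      have hSP := (disjoint_union_right.1 h.2).1
      have hSP' := (disjoint_union_right.1 h.2).2
      have c1 : Q' ⊆ S \ Q ∪ P := (subset_sdiff.2 ⟨hQS', hQQ.symm⟩).trans subset_union_left
      have c2 : Disjoint (S \ Q ∪ P) P' :=
        disjoint_union_left.2 ⟨hSP'.mono_left sdiff_subset, hPP⟩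
      rw [if_pos (⟨hQS, hSP⟩ : Q ⊆ S ∧ Disjoint S P),
        if_pos (⟨c1, c2⟩ : Q' ⊆ S \ Q ∪ P ∧ Disjoint (S \ Q ∪ P) P'), if_pos h]
      -- `S₀`, and `G₀` below, are the spectator modes. Every sign factors into signs between these
      -- and `P`, `P'`, `Q`, `Q'`.
      obtain ⟨S₀, hS₀⟩ : ∃ S₀, S₀ = S \ (Q ∪ Q') := ⟨_, rfl⟩
      have dQ : Disjoint S₀ Q := hS₀ ▸ disjoint_sdiff_self_left.mono_right subset_union_left
      have dQ' : Disjoint S₀ Q' := hS₀ ▸ disjoint_sdiff_self_left.mono_right subset_union_right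
      have dP : Disjoint S₀ P := hS₀ ▸ hSP.mono_left sdiff_subset
      have e1 : S \ Q = S₀ ∪ Q' := by
        rw [hS₀, sdiff_union_distrib]
        ext x
        have := @hQS' x
        have : x ∈ Q → x ∉ Q' := fun hx => disjoint_left.1 hQQ hx
        simp only [mem_sdiff, mem_union, mem_inter]
        tauto
      have e2 : (S \ Q ∪ P) \ Q' = S₀ ∪ P := by
        rw [e1, union_right_comm, union_sdiff_right]
        exact sdiff_eq_self_of_disjoint (disjoint_union_left.2 ⟨dQ', hPQ'⟩)
      obtain ⟨G₀, hG₀⟩ : ∃ G₀, G₀ = G \ (P ∪ P') := ⟨_, rfl⟩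
      have dG : Disjoint G₀ P := hG₀ ▸ disjoint_sdiff_self_left.mono_right subset_union_left
      have dG' : Disjoint G₀ P' := hG₀ ▸ disjoint_sdiff_self_left.mono_right subset_union_right
      have g1 : G \ P = G₀ ∪ P' := by
        rw [hG₀]
        ext x
        have := @hP' x
        have : x ∈ P → x ∉ P' := fun hx => disjoint_left.1 hPP hx
        simp only [mem_sdiff, mem_union]
        tauto
      have g2 : G \ P' = G₀ ∪ P := by
        rw [hG₀]
        ext x
        have := @hP x
        have : x ∈ P → x ∉ P' := fun hx => disjoint_left.1 hPP hx
        simp only [mem_sdiff, mem_union]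
        tauto
      rw [e2, e1, g1, g2, ← hS₀, ← hG₀, sgn_union_left _ dQ', sgn_union_left _ dQ',
        sgn_union_left _ dP, sgn_union_left _ dP, sgn_union_left _ dG', sgn_union_left _ dG,
        sgn_union_right _ hPP, sgn_union_right _ hQQ, sgn_union_right _ hPP, union_assoc]
      -- The two reorderings, of `Q'` with `Q` and of `P` with `Q'`, cost the same sign because |P|
      -- = |Q| and |P'| = |Q'|; the costs cancel.
      have s1 : sgn Q' Q = (-1) ^ (P.card * P'.card) * sgn Q Q' := by
        rw [sgn_swap hQQ.symm, ← hc, ← hc', mul_comm P'.card]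
      have s2 : sgn P Q' = (-1) ^ (P.card * P'.card) * sgn Q' P := by
        rw [sgn_swap hPQ', ← hc']
      have s3 : ((-1 : ℂ) ^ (P.card * P'.card)) * (-1) ^ (P.card * P'.card) = 1 := by
        rw [← mul_pow]; simp
      rw [s1, s2]
      generalize ((-1 : ℂ) ^ (P.card * P'.card)) = ε at s3
      have hpp := sgn_mul_self P P'
      have hqp := sgn_mul_self Q' P
      linear_combination (exp := 1) (sgn G₀ P * sgn P' P * sgn G₀ P' * sgn P P' * sgn S₀ Q *
        sgn Q Q' * sgn S₀ P * sgn S₀ Q' * sgn S₀ P' * sgn P P' * w (S₀ ∪ (P ∪ P'))) *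
          (ε * ε * hqp + s3) + (sgn G₀ P * sgn P' P * sgn G₀ P' * sgn S₀ Q *
        sgn Q Q' * sgn S₀ P * sgn S₀ Q' * sgn S₀ P' * w (S₀ ∪ (P ∪ P'))) * hpp
    · rw [if_neg h, mul_zero]
      by_cases h1 : Q ⊆ S ∧ Disjoint S P
      · rw [if_pos h1, if_neg, mul_zero, mul_zero, mul_zero]
        intro h2
        apply h
        refine ⟨union_subset h1.1 ?_, disjoint_union_right.2 ⟨h1.2, ?_⟩⟩
        · intro x hx
          rcases mem_union.1 (h2.1 hx) with h3 | h3
          · exact (mem_sdiff.1 h3).1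
          · exact absurd hx (disjoint_left.1 hPQ' h3)
        · rw [← sdiff_union_of_subset h1.1]
          exact disjoint_union_left.2 ⟨(disjoint_union_left.1 h2.2).1, hP'Q.symm⟩
      · rw [if_neg h1]
  · rw [if_neg hd]
    by_cases h1 : Q ⊆ S ∧ Disjoint S P
    · rw [if_pos h1, if_neg, mul_zero, mul_zero, mul_zero]
      intro h2
      refine hd ⟨(disjoint_union_left.1 h2.2).2, ?_⟩
      refine disjoint_left.2 fun x hx hx' => ?_
      rcases mem_union.1 (h2.1 hx') with h3 | h3
      · exact (mem_sdiff.1 h3).2 hx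
      · exact disjoint_left.1 hPQ h3 hx
    · rw [if_neg h1]

end Monomials

/-! ### Quadratic relations from powers of Ω. -/

section Plucker

variable {l : ℕ}

/-- The component of a two-copy state along `|S⟩ ⊗ |S'⟩`. -/
noncomputable def pairCoeff (S S' : Finset (Fin l)) :
    TensorProduct ℂ (Fock l) (Fock l) →ₗ[ℂ] ℂ :=
  LinearMap.mul' ℂ ℂ ∘ₗ TensorProduct.map (LinearMap.proj S) (LinearMap.proj S')

@[simp] theorem pairCoeff_tmul (S S' : Finset (Fin l)) (v w : Fock l) :
    pairCoeff S S' (TensorProduct.tmul ℂ v w) = v S * w S' := by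
  simp [pairCoeff]

/-- Read on output components, `ann r` needs `r ∉ S` and `cre r` needs `r ∈ S'`, so only `r ∈ S' \
S` survive. -/
theorem pairCoeff_Omega (S S' : Finset (Fin l)) (Φ : TensorProduct ℂ (Fock l) (Fock l)) :
    pairCoeff S S' (Omega l Φ) = ∑ r ∈ S' \ S,
      sgn S {r} * sgn (S'.erase r) {r} * pairCoeff (insert r S) (S'.erase r) Φ := by
  induction Φ with
  | zero => simp
  | add x y hx hy => simp [hx, hy, mul_add, sum_add_distrib]
  | tmul v w =>
    rw [Omega, LinearMap.sum_apply, map_sum]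
    simp only [TensorProduct.map_tmul, pairCoeff_tmul]
    rw [← sum_subset (subset_univ (S' \ S))]
    · refine sum_congr rfl fun r hr => ?_
      rw [mem_sdiff] at hr
      simp only [ann, cre, LinearMap.coe_mk, AddHom.coe_mk, if_neg hr.2, if_pos hr.1]
      ring
    · intro r _ hr
      rw [mem_sdiff] at hr
      by_cases h : r ∈ S <;> by_cases h' : r ∈ S' <;> simp_all [ann, cre]

/-- Ω^j moves `j` modes of `S' \ S` from one index to the other. All j! orders of moving a set `R`
contribute equally, because each exchange of two modes changes a sign in both factors; the
reordering signs accumulate to (-1)^{j choose 2}. -/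
theorem pairCoeff_Omega_pow (j : ℕ) (S S' : Finset (Fin l))
    (Φ : TensorProduct ℂ (Fock l) (Fock l)) :
    pairCoeff S S' ((Omega l ^ j) Φ) = (j.factorial : ℂ) * (-1) ^ (j.choose 2) *
      ∑ R ∈ (S' \ S).powersetCard j,
        sgn S R * sgn (S' \ R) R * pairCoeff (S ∪ R) (S' \ R) Φ := by
  induction j generalizing S S' with
  | zero => simp
  | succ j ih =>
    rw [pow_succ', Module.End.mul_apply, pairCoeff_Omega]
    simp only [ih]
    -- Joining `r` to `R` costs σ({r}, R) σ(R, {r}) = (-1)^j, whatever the position of `r` in `R`.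
    have key : ∀ r ∈ S' \ S, ∀ R ∈ ((S'.erase r) \ (insert r S)).powersetCard j,
        sgn S {r} * sgn (S'.erase r) {r} * (sgn (insert r S) R * sgn (S'.erase r \ R) R *
          pairCoeff (insert r S ∪ R) (S'.erase r \ R) Φ) =
        (-1) ^ j * (sgn S (insert r R) * sgn (S' \ insert r R) (insert r R) *
          pairCoeff (S ∪ insert r R) (S' \ insert r R) Φ) := by
      intro r hr R hR
      rw [mem_sdiff] at hr
      rw [mem_powersetCard] at hR
      have hrR : r ∉ R := fun h => by simpa using hR.1 h
      have hRS : R ⊆ S' := hR.1.trans (sdiff_subset.trans (erase_subset _ _))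
      have e1 : S'.erase r \ R = S' \ insert r R := by
        ext; simp; tauto
      have e2 : S'.erase r = (S' \ insert r R) ∪ R := by
        rw [← e1, sdiff_union_of_subset]
        exact subset_erase.2 ⟨hRS, hrR⟩
      have e3 : insert r S ∪ R = S ∪ insert r R := by
        ext; simp
      have d1 : Disjoint (S' \ insert r R) R :=
        disjoint_sdiff_self_left.mono_right (subset_insert _ _)
      have d2 : Disjoint ({r} : Finset (Fin l)) R := by simpa using hrR
      have d3 : Disjoint ({r} : Finset (Fin l)) S := by simpa using hr.2
      have hs := sgn_mul_sgn_swap d2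
      rw [card_singleton, one_mul, hR.2] at hs
      rw [e1, e3, e2, insert_eq r S, sgn_union_left _ d1, sgn_union_left _ d3, ← hs]
      generalize pairCoeff _ _ Φ = c
      rw [insert_eq r R, sgn_union_right _ d2, sgn_union_right _ d2]
      ring
    simp only [mul_sum]
    have : ∀ r ∈ S' \ S, (∑ R ∈ ((S'.erase r) \ (insert r S)).powersetCard j,
        sgn S {r} * sgn (S'.erase r) {r} * ((j.factorial : ℂ) * (-1) ^ (j.choose 2) *
          (sgn (insert r S) R * sgn (S'.erase r \ R) R *
          pairCoeff (insert r S ∪ R) (S'.erase r \ R) Φ))) =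
        ∑ U ∈ ((S' \ S).powersetCard (j + 1)).filter (r ∈ ·),
          (j.factorial : ℂ) * (-1) ^ (j.choose 2) * (-1) ^ j *
          (sgn S U * sgn (S' \ U) U * pairCoeff (S ∪ U) (S' \ U) Φ) := by
      intro r hr
      refine sum_bij' (fun R _ => insert r R) (fun U _ => U.erase r) ?_ ?_ ?_ ?_ ?_
      · intro R hR
        have hR' := mem_powersetCard.1 hR
        have hrR : r ∉ R := fun h => by simpa using hR'.1 h
        rw [mem_filter, mem_powersetCard, card_insert_of_notMem hrR, hR'.2]
        refine ⟨⟨insert_subset hr fun x hx => ?_, rfl⟩, mem_insert_self _ _⟩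
        have := hR'.1 hx
        simp only [mem_sdiff, mem_erase, mem_insert] at this ⊢
        tauto
      · intro U hU
        rw [mem_filter, mem_powersetCard] at hU
        rw [mem_powersetCard, card_erase_of_mem hU.2, hU.1.2]
        refine ⟨fun x hx => ?_, rfl⟩
        have h1 := mem_erase.1 hx
        have := hU.1.1 h1.2
        simp only [mem_sdiff, mem_erase, mem_insert] at this ⊢
        tauto
      · intro R hR
        have hR' := mem_powersetCard.1 hR
        exact erase_insert fun h => by simpa using hR'.1 h
      · intro U hU
        exact insert_erase (mem_filter.1 hU).2
      · intro R hR
        linear_combination (j.factorial : ℂ) * (-1) ^ (j.choose 2) * key r hr R hR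
    rw [sum_congr rfl this]
    simp only [sum_filter]
    rw [sum_comm]
    refine sum_congr rfl fun U hU => ?_
    rw [mem_powersetCard] at hU
    -- Each `U` is counted once for each of its j + 1 elements `r`, which turns j! into (j + 1)!.
    rw [← sum_filter, sum_const, filter_mem_eq_inter, inter_eq_right.2 hU.1, hU.2, nsmul_eq_mul,
      Nat.factorial_succ, Nat.choose_succ_succ' j 1, Nat.choose_one_right, pow_add]
    push_cast
    ring

/-- The quadratic relations satisfied by the amplitudes of a state annihilated by `Ω^j`. -/
theorem sum_eq_zero_of_Omega_pow {j : ℕ} {v : Fock l}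
    (h : (Omega l ^ j) (TensorProduct.tmul ℂ v v) = 0) (S S' : Finset (Fin l)) :
    ∑ R ∈ (S' \ S).powersetCard j, sgn S R * sgn (S' \ R) R * (v (S ∪ R) * v (S' \ R)) = 0 := by
  have h1 := pairCoeff_Omega_pow j S S' (TensorProduct.tmul ℂ v v)
  rw [h, map_zero] at h1
  simp only [pairCoeff_tmul] at h1
  refine (mul_eq_zero.1 h1.symm).resolve_left ?_
  exact mul_ne_zero (by exact_mod_cast j.factorial_ne_zero) (pow_ne_zero _ (by norm_num))

end Plucker

/-! ### Vanishing of the connected amplitudes of high order. -/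

section Connected

variable {l : ℕ}

theorem sgn_sq (A B : Finset (Fin l)) : sgn A B ^ 2 = 1 := by rw [sq, sgn_mul_self]

/-- To be read with X = G ∖ P, P = A ∪ B, E = q ∪ C and Q = E ∪ D. On the right, the first three
signs depend only on G, P, Q and q; the rest are the signs occurring in `ampProd`. Thus the Plücker
sign and that of `ampProd` differ by a factor independent of the splitting (A, E). -/
theorem plucker_sign {X A B q C D : Finset (Fin l)} (hXA : Disjoint X A) (hXB : Disjoint X B)
    (hXq : Disjoint X q) (hXD : Disjoint X D) (hAB : Disjoint A B)
    (hAD : Disjoint A D) (hBq : Disjoint B q) (hBC : Disjoint B C) (hBD : Disjoint B D)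
    (hqC : Disjoint q C) (hqD : Disjoint q D) (hCD : Disjoint C D)
    (h1 : q.card = 1) (hA : A.card = C.card + 1) (hB : B.card = D.card) :
    sgn (X ∪ q) (B ∪ C) * sgn (X ∪ A ∪ D) (B ∪ C) =
      sgn X (q ∪ C ∪ D) * sgn q (C ∪ D) * sgn (A ∪ B) (C ∪ D) * (-1) ^ B.card *
        (sgn (X ∪ B) (q ∪ C) * sgn (X ∪ A) D * sgn B A * sgn (q ∪ C) D) := by
  have e1 := sgn_swap hBq.symm
  have e2 := sgn_swap hAB
  have e3 := sgn_swap hBD.symm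
  have e4 := sgn_swap hCD.symm
  rw [h1, one_mul] at e1
  rw [hA, add_mul, one_mul, pow_add, mul_comm C.card] at e2
  rw [← hB, pow_mul] at e3
  rw [← hB] at e4
  have hbb : ((-1 : ℂ) ^ B.card) ^ B.card = (-1) ^ B.card := by
    rcases Nat.even_or_odd B.card with h | h
    · simp [h.neg_one_pow]
    · simp [h.neg_one_pow]
  have hε : ((-1 : ℂ) ^ B.card) ^ 2 = 1 := by rw [← pow_mul, mul_comm, pow_mul]; simp
  have hδ : ((-1 : ℂ) ^ (B.card * C.card)) ^ 2 = 1 := by rw [← pow_mul, mul_comm, pow_mul]; simp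
  rw [hbb] at e3
  have d1 : Disjoint (X ∪ A) D := disjoint_union_left.2 ⟨hXD, hAD⟩
  have d2 : Disjoint (q ∪ C) D := disjoint_union_left.2 ⟨hqD, hCD⟩
  simp only [sgn_union_left _ hXq, sgn_union_left _ d1, sgn_union_left _ hXA,
    sgn_union_left _ hXB, sgn_union_left _ hAB, sgn_union_left _ hqC,
    sgn_union_right _ d2, sgn_union_right _ hqC, sgn_union_right _ hCD, sgn_union_right _ hBC]
  rw [e1, e2, e3, e4]
  generalize ((-1 : ℂ) ^ (B.card * C.card)) = δ at hδ
  generalize ((-1 : ℂ) ^ B.card) = ε at hε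
  ring_nf
  simp only [sgn_sq, hδ, mul_one, one_mul, show ε ^ 3 = ε by linear_combination ε * hε]

/-- The summand in the connected amplitudes, without the weight of `P'`. -/
noncomputable def ampProd (G : Finset (Fin l)) (v : Fock l) (P Q P' Q' : Finset (Fin l)) : ℂ :=
  (-1) ^ (P \ P').card * (relAmp G v P' Q' * relAmp G v (P \ P') (Q \ Q') *
    (sgn (P \ P') P' * sgn Q' (Q \ Q')))

theorem relAmp_empty {G : Finset (Fin l)} {v : Fock l} (hv : v G ≠ 0) : relAmp G v ∅ ∅ = 1 := by
  simp [relAmp, hv]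

/-- The leading term a_{P,Q} is the missing summand P' = P, because a_{∅,∅} = 1; multiplying by |P|
clears the denominators. -/
theorem card_mul_connAmp {G : Finset (Fin l)} {v : Fock l} (hv : v G ≠ 0)
    {P Q : Finset (Fin l)} (hc : P.card = Q.card) (hP : 1 ≤ P.card) :
    (P.card : ℂ) * connAmp G v P Q = ∑ P' ∈ P.powerset,
      ∑ Q' ∈ Q.powerset.filter (fun Q' => Q'.card = P'.card),
        (P'.card : ℂ) * ampProd G v P Q P' Q' := by
  have hne : (P.card : ℂ) ≠ 0 := by
    rw [Nat.cast_ne_zero]; omega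
  rw [← add_sum_erase _ _ (mem_powerset_self P)]
  have hQ : Q.powerset.filter (fun Q' => Q'.card = P.card) = {Q} := by
    ext U
    simp only [mem_filter, mem_powerset, mem_singleton]
    exact ⟨fun h => eq_of_subset_of_card_le h.1 (by omega), by rintro rfl; exact ⟨subset_rfl, hc.symm⟩⟩
  rw [hQ, sum_singleton]
  have hself : ampProd G v P Q P Q = relAmp G v P Q := by
    simp [ampProd, relAmp_empty hv]
  rw [hself, connAmp, mul_sub, sub_eq_add_neg, mul_sum, ← sum_neg_distrib]
  congr 1
  refine sum_congr rfl fun P' hP' => ?_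
  have hlt : P'.card < P.card := card_lt_card (mem_ssubsets.1 hP')
  have hf : Q.ssubsets.filter (fun Q' => Q'.card = P'.card) =
      Q.powerset.filter (fun Q' => Q'.card = P'.card) := by
    ext U
    simp only [mem_filter, mem_powerset, mem_ssubsets]
    refine ⟨fun h => ⟨h.1.1, h.2⟩, fun h => ⟨Finset.ssubset_iff_subset_ne.2 ⟨h.1, ?_⟩, h.2⟩⟩
    rintro rfl
    omega
  rw [hf, mul_sum, ← sum_neg_distrib]
  refine sum_congr rfl fun Q' _ => ?_
  rw [ampProd, pow_succ]
  field_simp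

/-- Transferring R = (P ∖ A) ∪ (E ∖ q) from (G ∪ Q) ∖ q to (G ∖ P) ∪ q yields the sets (G ∖ A) ∪ E
and (G ∖ (P ∖ A)) ∪ (Q ∖ E), whose amplitudes are a_{A,E} and a_{P∖A,Q∖E} up to sign and
normalisation. -/
theorem plucker_term {G : Finset (Fin l)} {v : Fock l} (hv : v G ≠ 0)
    {P Q A E : Finset (Fin l)} (hP : P ⊆ G) (hQ : Disjoint G Q) (hc : P.card = Q.card)
    (hA : A ⊆ P) (hE : E ⊆ Q) (hcard : E.card = A.card) {q : Fin l} (hqE : q ∈ E) :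
    sgn (G \ P ∪ {q}) (P \ A ∪ E.erase q) *
        sgn ((G ∪ Q).erase q \ (P \ A ∪ E.erase q)) (P \ A ∪ E.erase q) *
        (v (G \ P ∪ {q} ∪ (P \ A ∪ E.erase q)) * v ((G ∪ Q).erase q \ (P \ A ∪ E.erase q))) =
      sgn (G \ P) Q * sgn {q} (Q.erase q) * sgn P (Q.erase q) * (v G * v G) *
        ampProd G v P Q A E := by
  have hq : q ∈ Q := hE hqE
  have hPQ := hQ.mono_left hP
  obtain ⟨X, hX⟩ : ∃ X, X = G \ P := ⟨_, rfl⟩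
  obtain ⟨B, hB⟩ : ∃ B, B = P \ A := ⟨_, rfl⟩
  obtain ⟨C, hC⟩ : ∃ C, C = E.erase q := ⟨_, rfl⟩
  obtain ⟨D, hD⟩ : ∃ D, D = Q \ E := ⟨_, rfl⟩
  have hXG : X ⊆ G := hX ▸ sdiff_subset
  have hBP : B ⊆ P := hB ▸ sdiff_subset
  have hqC : q ∉ C := by simp [hC]
  have hEeq : E = {q} ∪ C := by rw [hC, ← insert_eq, insert_erase hqE]
  have hCQ : C ⊆ Q := hC ▸ (erase_subset _ _).trans hE
  have hDQ : D ⊆ Q := hD ▸ sdiff_subset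
  have hED : Disjoint E D := hD ▸ disjoint_sdiff
  have hqD : q ∉ D := disjoint_left.1 hED hqE
  have hXP : Disjoint X P := hX ▸ disjoint_sdiff_self_left
  have hAB : Disjoint A B := hB ▸ disjoint_sdiff
  have hCD : Disjoint C D := hED.mono_left (hC ▸ erase_subset _ _)
  have hPeq : P = A ∪ B := by rw [hB, union_sdiff_of_subset hA]
  have hQeq : Q = {q} ∪ C ∪ D := by rw [← hEeq, hD, union_sdiff_of_subset hE]
  have hQq : Q.erase q = C ∪ D := by
    rw [hQeq, union_assoc, ← insert_eq, erase_insert]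
    simp [hqC, hqD]
  have hGA : G \ A = X ∪ B := by
    ext x
    have h1 := @hP x
    have h2 := @hA x
    simp only [hX, hB, mem_sdiff, mem_union]
    tauto
  have hGB : G \ B = X ∪ A := by
    ext x
    have h1 := @hP x
    have h2 := @hA x
    simp only [hX, hB, mem_sdiff, mem_union]
    tauto
  have v1 : G \ P ∪ {q} ∪ (B ∪ C) = X ∪ B ∪ E := by
    rw [← hX, hEeq]
    ext; simp only [mem_union]; tauto
  have v2 : (G ∪ Q).erase q \ (B ∪ C) = X ∪ A ∪ D := by
    ext x
    have h1 := @hP x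
    have h2 := @hA x
    have h4 := @hE x
    have h5 : x ∈ G → x ∉ Q := fun hx => disjoint_left.1 hQ hx
    have h6 : x = q → x ∈ E := by rintro rfl; exact hqE
    simp only [hX, hB, hC, hD, mem_sdiff, mem_union, mem_erase]
    clear * - h1 h2 h4 h5 h6
    by_cases a1 : x = q
    · have := h6 a1
      tauto
    · simp only [a1, ne_eq, not_false_eq_true, true_and]
      tauto
  have dPQ : ∀ {U V : Finset (Fin l)}, U ⊆ P → V ⊆ Q → Disjoint U V :=
    fun hu hv => hPQ.mono hu hv
  have hsq : ({q} : Finset (Fin l)) ⊆ Q := by simpa using hq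
  have c1 : C.card + 1 = E.card := by
    rw [hEeq, card_union_of_disjoint (by simpa using hqC), card_singleton, add_comm]
  have c2 : P.card = A.card + B.card := by rw [hPeq, card_union_of_disjoint hAB]
  have c3 : Q.card = E.card + D.card := by rw [hD, card_sdiff_of_subset hE]; have := card_le_card hE; omega
  have hsign := plucker_sign (X := X) (A := A) (B := B) (q := {q}) (C := C) (D := D)
    (hXP.mono_right hA) (hXP.mono_right hBP) (hQ.mono hXG hsq) (hQ.mono hXG hDQ) hAB
    (dPQ hA hDQ) (dPQ hBP hsq) (dPQ hBP hCQ) (dPQ hBP hDQ) (by simpa using hqC)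
    (by simpa using hqD) hCD (card_singleton q) (by omega)
    (by omega)
  rw [← hPeq, ← hQeq, ← hEeq] at hsign
  rw [ampProd, relAmp, relAmp, hQq, ← hB, ← hC, v1, v2, hGA, hGB, ← hX, ← hD, hsign]
  field_simp

/-- This is the relation for S = (G ∖ P) ∪ q and S' = (G ∪ Q) ∖ q. Here S' ∖ S = P ∪ (Q ∖ q), and
its subsets of size |P| - 1 correspond to the pairs (A, E) with |A| = |E| and q ∈ E. -/
theorem sum_ampProd_mem_eq_zero {G : Finset (Fin l)} {v : Fock l}
    {P Q : Finset (Fin l)} (hP : P ⊆ G) (hQ : Disjoint G Q) (hc : P.card = Q.card)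
    (hΩ : (Omega l ^ (P.card - 1)) (TensorProduct.tmul ℂ v v) = 0) {q : Fin l} (hq : q ∈ Q) :
    ∑ e ∈ (P.powerset ×ˢ Q.powerset).filter (fun e => e.2.card = e.1.card ∧ q ∈ e.2),
      ampProd G v P Q e.1 e.2 = 0 := by
  have h := sum_eq_zero_of_Omega_pow hΩ (G \ P ∪ {q}) ((G ∪ Q).erase q)
  have hqG : q ∉ G := fun h => disjoint_left.1 hQ h hq
  have hPQ := hQ.mono_left hP
  have hqP : q ∉ P := fun h => hqG (hP h)
  have hdiff : (G ∪ Q).erase q \ (G \ P ∪ {q}) = P ∪ Q.erase q := by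
    ext x
    have h1 := @hP x
    have h2 : x ∈ Q → x ∉ G := fun hx hg => disjoint_left.1 hQ hg hx
    have h3 : x = q → x ∉ P := by rintro rfl; exact hqP
    simp only [mem_sdiff, mem_erase, mem_union, mem_singleton]
    tauto
  have hcQ : 1 ≤ Q.card := card_pos.2 ⟨q, hq⟩
  rw [hdiff] at h
  set c := sgn (G \ P) Q * sgn {q} (Q.erase q) * sgn P (Q.erase q) * (v G * v G) with hcdef
  -- If `v G = 0`, division by zero makes every relative amplitude 0.
  by_cases hv : v G = 0
  · refine sum_eq_zero fun e _ => ?_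
    simp [ampProd, relAmp, hv]
  have hc0 : c ≠ 0 := by simp [hcdef, sgn_ne_zero, hv]
  refine (mul_eq_zero.1 ?_).resolve_left hc0
  rw [mul_sum, ← h]
  refine sum_bij' (fun e _ => (P \ e.1) ∪ e.2.erase q) (fun R _ => (P \ R, insert q (R ∩ Q)))
    ?_ ?_ ?_ ?_ ?_
  · rintro ⟨A, E⟩ he
    simp only [mem_filter, mem_product, mem_powerset] at he
    obtain ⟨⟨hA, hE⟩, hcard, hqE⟩ := he
    rw [mem_powersetCard]
    refine ⟨union_subset_union sdiff_subset (erase_subset_erase _ hE), ?_⟩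
    have hd : Disjoint (P \ A) (E.erase q) :=
      hPQ.mono sdiff_subset ((erase_subset _ _).trans hE)
    rw [card_union_of_disjoint hd, card_sdiff_of_subset hA, card_erase_of_mem hqE]
    have := card_le_card hA
    have : 1 ≤ E.card := card_pos.2 ⟨q, hqE⟩
    omega
  · intro R hR
    rw [mem_powersetCard] at hR
    simp only [mem_filter, mem_product, mem_powerset, sdiff_subset, mem_insert_self, and_true,
      true_and]
    refine ⟨insert_subset hq inter_subset_right, ?_⟩
    have hqR : q ∉ R := fun h => by simpa [hqP] using hR.1 h
    rw [card_insert_of_notMem (by simp [hqR]), card_sdiff]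
    have hsplit : R = (R ∩ P) ∪ (R ∩ Q) := by
      rw [← inter_union_distrib_left, eq_comm, inter_eq_left]
      exact hR.1.trans (union_subset_union_right (erase_subset _ _))
    have h2 := hR.2
    rw [hsplit, card_union_of_disjoint (hPQ.mono inter_subset_right inter_subset_right)] at h2
    have h3 : 1 ≤ P.card := by omega
    omega
  · rintro ⟨A, E⟩ he
    simp only [mem_filter, mem_product, mem_powerset] at he
    obtain ⟨⟨hA, hE⟩, hcard, hqE⟩ := he
    refine Prod.ext ?_ ?_
    · ext x
      have h1 := @hA x
      have h2 := @hE x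
      have h3 : x ∈ P → x ∉ Q := fun hx => disjoint_left.1 hPQ hx
      simp only [mem_sdiff, mem_union, mem_erase]
      tauto
    · ext x
      have h1 := @hA x
      have h2 := @hE x
      have h3 : x ∈ P → x ∉ Q := fun hx => disjoint_left.1 hPQ hx
      have h4 : x = q → x ∈ E := by rintro rfl; exact hqE
      simp only [mem_sdiff, mem_union, mem_erase, mem_insert, mem_inter]
      tauto
  · intro R hR
    rw [mem_powersetCard] at hR
    ext x
    have h1 : x ∈ R → x ∈ P ∪ Q.erase q := fun hx => hR.1 hx
    have h4 : x = q → x ∈ Q := by rintro rfl; exact hq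
    have h3 : x ∈ P → x ∉ Q := fun hx => disjoint_left.1 hPQ hx
    simp only [mem_sdiff, mem_union, mem_erase, mem_insert, mem_inter] at h1 ⊢
    tauto
  · rintro ⟨A, E⟩ he
    simp only [mem_filter, mem_product, mem_powerset] at he
    obtain ⟨⟨hA, hE⟩, hcard, hqE⟩ := he
    exact (plucker_term hv hP hQ hc hA hE hcard hqE).symm

/-- The connected amplitudes of order greater than `k` of a state of `𝒢_k` vanish. -/
theorem connAmp_eq_zero {G : Finset (Fin l)} {v : Fock l} (hv : v G ≠ 0) {k : ℕ}
    (hΩ : (Omega l ^ k) (TensorProduct.tmul ℂ v v) = 0)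
    {P Q : Finset (Fin l)} (hP : P ⊆ G) (hQ : Disjoint G Q) (hc : P.card = Q.card)
    (hk : k < P.card) : connAmp G v P Q = 0 := by
  have hΩ' : (Omega l ^ (P.card - 1)) (TensorProduct.tmul ℂ v v) = 0 := by
    rw [show P.card - 1 = (P.card - 1 - k) + k by omega, pow_add, Module.End.mul_apply, hΩ,
      map_zero]
  have hne : (P.card : ℂ) ≠ 0 := by
    rw [Nat.cast_ne_zero]; omega
  refine (mul_eq_zero.1 ?_).resolve_left hne
  rw [card_mul_connAmp hv hc (by omega)]
  -- Summed over q ∈ Q, a pair (A, E) is counted |E| = |A| times, which is its weight in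
  -- `card_mul_connAmp`.
  have h := sum_eq_zero (s := Q) fun q hq => sum_ampProd_mem_eq_zero hP hQ hc hΩ' hq
  simp only [sum_filter] at h ⊢
  rw [sum_comm, sum_product] at h
  refine Eq.trans (sum_congr rfl fun A _ => sum_congr rfl fun E hE => ?_) h
  by_cases hcard : E.card = A.card
  · simp only [hcard, if_true, true_and]
    rw [← sum_filter, sum_const, filter_mem_eq_inter, inter_eq_right.2 (mem_powerset.1 hE),
      hcard, nsmul_eq_mul]
  · simp [hcard]

end Connected

/-! ### The recursion for ν/𝐦! and its absolute convergence. -/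

section Coefficients

variable {k : ℕ}

/-- Indexes the Cauchy product of power series in `k` variables. -/
instance : HasAntidiagonal (Fin k → ℕ) := HasAntidiagonal.antidiagonalOfLocallyFinite

@[simp] theorem weight_zero : weight (0 : Fin k → ℕ) = 0 := by simp [weight]

theorem weight_add (m m' : Fin k → ℕ) : weight (m + m') = weight m + weight m' := by
  simp [weight, mul_add, sum_add_distrib]

theorem weight_single (i : Fin k) : weight (Pi.single i 1 : Fin k → ℕ) = i + 1 := by
  simp [weight, Pi.single_apply]

theorem le_weight (m : Fin k → ℕ) (i : Fin k) : m i ≤ weight m :=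
  (Nat.le_mul_of_pos_left _ (Nat.succ_pos _)).trans
    (single_le_sum (f := fun i : Fin k => ((i : ℕ) + 1) * m i) (fun _ _ => Nat.zero_le _)
      (mem_univ i))

theorem weight_mono {m m' : Fin k → ℕ} (h : m ≤ m') : weight m ≤ weight m' :=
  sum_le_sum fun i _ => Nat.mul_le_mul_left _ (h i)

theorem weight_eq_zero_iff {m : Fin k → ℕ} : weight m = 0 ↔ m = 0 := by
  refine ⟨fun h => ?_, by rintro rfl; simp⟩
  funext i
  exact Nat.le_zero.1 (h ▸ le_weight m i)

theorem sum_eq_one_iff {m : Fin k → ℕ} : ∑ i, m i = 1 ↔ ∃ i, m = Pi.single i 1 := by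
  constructor
  · intro h
    obtain ⟨i, hi⟩ : ∃ i, m i ≠ 0 := by
      by_contra! h'
      simp [h'] at h
    refine ⟨i, funext fun j => ?_⟩
    have hsum := add_sum_erase univ m (mem_univ i)
    by_cases hj : j = i
    · subst hj
      rw [Pi.single_eq_same]
      omega
    · rw [Pi.single_eq_of_ne hj]
      have := single_le_sum (f := m) (fun _ _ => Nat.zero_le _)
        (mem_erase.2 ⟨hj, mem_univ j⟩)
      omega
  · rintro ⟨i, rfl⟩
    simp

/-- The coefficient `ν(𝐦) / (m_1! ⋯ m_k!)`. -/
noncomputable def coeffF (m : Fin k → ℕ) : ℂ := (nu m : ℂ) / ∏ i, ((m i).factorial : ℂ)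

theorem coeffF_of_sum_le_one {m : Fin k → ℕ} (h : ∑ i, m i ≤ 1) : coeffF m = 1 := by
  have : ∀ i, (m i).factorial = 1 := fun i => by
    rw [Nat.factorial_eq_one]
    exact (single_le_sum (f := m) (fun _ _ => Nat.zero_le _) (mem_univ i)).trans h
  rw [coeffF, nu, if_pos h]
  simp [this]

@[simp] theorem coeffF_zero : coeffF (0 : Fin k → ℕ) = 1 := coeffF_of_sum_le_one (by simp)

/-- Dividing by the factorials absorbs the binomials and makes the recursion a plain convolution. -/
theorem weight_mul_coeffF {m : Fin k → ℕ} (h : 1 < ∑ i, m i) :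
    (weight m : ℂ) * coeffF m = ∑ m' ∈ Ioo 0 m,
      (-1) ^ (weight (m - m') + 1) * (weight m' : ℂ) * (coeffF m' * coeffF (m - m')) := by
  have hw : (weight m : ℂ) ≠ 0 := by
    rw [Nat.cast_ne_zero, Ne, weight_eq_zero_iff]
    rintro rfl
    simp at h
  rw [coeffF, nu, if_neg (by omega), sum_attach (Ioo 0 m) fun m' : Fin k → ℕ =>
    (-1) ^ (weight (m - m') + 1) * ((weight m' : ℚ) / (weight m : ℚ)) *
      nu m' * nu (m - m') * ∏ i, ((m i).choose (m' i) : ℚ)]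
  push_cast
  rw [sum_div, mul_sum]
  refine sum_congr rfl fun m' hm' => ?_
  have hle : m' ≤ m := (mem_Ioo.1 hm').2.le
  have hfac : ∏ i, ((m i).factorial : ℂ) = (∏ i, ((m i).choose (m' i) : ℂ)) *
      (∏ i, ((m' i).factorial : ℂ)) * ∏ i, (((m - m') i).factorial : ℂ) := by
    rw [← prod_mul_distrib, ← prod_mul_distrib]
    refine prod_congr rfl fun i _ => ?_
    exact_mod_cast (Nat.choose_mul_factorial_mul_factorial (hle i)).symm
  have h0 : ∏ i, ((m i).choose (m' i) : ℂ) ≠ 0 :=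
    prod_ne_zero_iff.2 fun i _ => Nat.cast_ne_zero.2 (Nat.choose_pos (hle i)).ne'
  have h1 : ∏ i, ((m' i).factorial : ℂ) ≠ 0 :=
    prod_ne_zero_iff.2 fun i _ => Nat.cast_ne_zero.2 (Nat.factorial_ne_zero _)
  have h2 : ∏ i, (((m - m') i).factorial : ℂ) ≠ 0 :=
    prod_ne_zero_iff.2 fun i _ => Nat.cast_ne_zero.2 (Nat.factorial_ne_zero _)
  rw [hfac, coeffF, coeffF]
  field_simp

theorem sum_antidiagonal_eq_sum_Iic {M : Type*} [AddCommMonoid M] (m : Fin k → ℕ)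
    (f : (Fin k → ℕ) → (Fin k → ℕ) → M) :
    ∑ p ∈ antidiagonal m, f p.1 p.2 = ∑ m' ∈ Iic m, f m' (m - m') := by
  refine sum_bij' (fun p _ => p.1) (fun m' _ => (m', m - m')) ?_ ?_ ?_ ?_ ?_
  · intro p hp
    rw [HasAntidiagonal.mem_antidiagonal] at hp
    rw [mem_Iic, ← hp]
    exact le_self_add
  · intro m' hm'
    rw [mem_Iic] at hm'
    rw [HasAntidiagonal.mem_antidiagonal]
    exact add_tsub_cancel_of_le hm'
  · intro p hp
    rw [HasAntidiagonal.mem_antidiagonal] at hp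
    simp [← hp]
  · intro m' _
    rfl
  · intro p hp
    rw [HasAntidiagonal.mem_antidiagonal] at hp
    simp [← hp]

/-- The quadratic recursion for the coefficients of `F`, in the form of the differential equation
`A'(μ) A(-μ) = ∑_j j x_j μ^{j-1}`. -/
theorem sum_antidiagonal_coeffF (m : Fin k → ℕ) :
    ∑ p ∈ antidiagonal m, (-1) ^ weight p.2 * (weight p.1 : ℂ) * (coeffF p.1 * coeffF p.2) =
      if ∑ i, m i = 1 then (weight m : ℂ) else 0 := by
  rw [sum_antidiagonal_eq_sum_Iic m fun a b =>
    (-1) ^ weight b * (weight a : ℂ) * (coeffF a * coeffF b)]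
  by_cases hm : m = 0
  · subst hm
    have : Iic (0 : Fin k → ℕ) = {0} := by ext; simp
    simp [this]
  · have hpos : 0 < m := pos_iff_ne_zero.2 hm
    have hI : Iic m = insert 0 (insert m (Ioo 0 m)) := by
      ext x
      simp only [mem_Iic, mem_insert, mem_Ioo]
      constructor
      · intro hx
        by_cases h0 : x = 0
        · exact Or.inl h0
        · exact Or.inr (hx.eq_or_lt.imp id fun h => ⟨pos_iff_ne_zero.2 h0, h⟩)
      · rintro (rfl | rfl | h)
        · exact hpos.le
        · exact le_rfl
        · exact h.2.le
    -- The endpoint 0 has weight 0, and the endpoint `m` gives `weight m * coeffF m`, which the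
    -- recursion cancels against the interior when |m| > 1.
    rw [hI, sum_insert (by simp [hpos.ne]), sum_insert (by simp)]
    simp only [weight_zero, Nat.cast_zero, mul_zero, zero_mul, zero_add, tsub_self, pow_zero,
      one_mul, coeffF_zero, mul_one]
    split_ifs with h1
    · obtain ⟨i, rfl⟩ := sum_eq_one_iff.1 h1
      have hE : Ioo 0 (Pi.single i 1 : Fin k → ℕ) = ∅ := by
        refine eq_empty_of_forall_notMem fun x hx => ?_
        rw [mem_Ioo] at hx
        obtain ⟨hle, j, hj⟩ := Pi.lt_def.1 hx.2
        have hs : ∑ i, x i < ∑ j, (Pi.single i 1 : Fin k → ℕ) j :=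
          sum_lt_sum (fun i _ => hle i) ⟨j, mem_univ _, hj⟩
        obtain ⟨_, j', hj'⟩ := Pi.lt_def.1 hx.1
        have := single_le_sum (f := x) (fun _ _ => Nat.zero_le _) (mem_univ j')
        rw [Pi.zero_apply] at hj'
        omega
      rw [hE, sum_empty, add_zero, coeffF_of_sum_le_one h1.le, mul_one]
    · have h2 : 1 < ∑ i, m i := by
        have : ∑ i, m i ≠ 0 := fun h => hm <| funext fun i =>
          (sum_eq_zero_iff.1 h) i (mem_univ i)
        omega
      rw [weight_mul_coeffF h2, ← sum_add_distrib]
      refine sum_eq_zero fun x _ => ?_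
      rw [pow_succ]
      ring

/-- The ratio of weights in the recursion is at most 1. -/
theorem norm_coeffF_le {m : Fin k → ℕ} (h : 1 < ∑ i, m i) :
    ‖coeffF m‖ ≤ ∑ m' ∈ Ioo 0 m, ‖coeffF m'‖ * ‖coeffF (m - m')‖ := by
  have hw : 0 < (weight m : ℝ) := by
    rw [Nat.cast_pos, pos_iff_ne_zero, Ne, weight_eq_zero_iff]
    rintro rfl
    simp at h
  refine le_of_mul_le_mul_left ?_ hw
  have h1 := congrArg norm (weight_mul_coeffF h)
  rw [norm_mul, Complex.norm_natCast] at h1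
  rw [h1, mul_sum]
  refine (norm_sum_le _ _).trans (sum_le_sum fun m' hm' => ?_)
  rw [norm_mul, norm_mul, norm_mul, norm_pow, norm_neg, norm_one, one_pow, one_mul,
    Complex.norm_natCast]
  exact mul_le_mul_of_nonneg_right
    (Nat.cast_le.2 (weight_mono (mem_Ioo.1 hm').2.le)) (by positivity)

/-- The partial sums satisfy s_{N+1} ≤ k r + s_N², the first term coming from |m| = 1; with k r ≤
1/4 the bound 1/2 reproduces itself. -/
theorem sum_norm_coeffF_le {r : ℝ} (hr : 0 ≤ r) (hkr : k * r ≤ 1 / 4) (N : ℕ) :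
    ∑ m ∈ (Iic (fun _ : Fin k => N)).filter (fun m => m ≠ 0 ∧ ∑ i, m i ≤ N),
      ‖coeffF m‖ * r ^ (∑ i, m i) ≤ 1 / 2 := by
  induction N with
  | zero =>
    rw [sum_eq_zero]
    · norm_num
    · intro m hm
      rw [mem_filter, mem_Iic] at hm
      exact absurd (funext fun i => Nat.le_zero.1 (hm.1 i)) hm.2.1
  | succ N ih =>
    set I := (Iic (fun _ : Fin k => N)).filter (fun m => m ≠ 0 ∧ ∑ i, m i ≤ N) with hI
    have memI : ∀ m : Fin k → ℕ, m ≠ 0 → ∑ i, m i ≤ N → m ∈ I := fun m h0 h1 => by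
      rw [hI, mem_filter, mem_Iic]
      exact ⟨fun i => (single_le_sum (f := m) (fun _ _ => Nat.zero_le _) (mem_univ i)).trans h1,
        h0, h1⟩
    rw [← sum_filter_add_sum_filter_not _ (fun m => ∑ i, m i = 1)]
    have h1 : ∑ m ∈ ((Iic (fun _ : Fin k => N + 1)).filter
        (fun m => m ≠ 0 ∧ ∑ i, m i ≤ N + 1)).filter (fun m => ∑ i, m i = 1),
        ‖coeffF m‖ * r ^ (∑ i, m i) ≤ 1 / 4 := by
      refine le_trans ?_ hkr
      calc _ ≤ ∑ m ∈ univ.image (fun i : Fin k => (Pi.single i 1 : Fin k → ℕ)),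
            ‖coeffF m‖ * r ^ (∑ i, m i) := by
            refine sum_le_sum_of_subset_of_nonneg (fun m hm => ?_) fun _ _ _ => by positivity
            obtain ⟨i, rfl⟩ := sum_eq_one_iff.1 (mem_filter.1 hm).2
            exact mem_image_of_mem _ (mem_univ i)
        _ ≤ ∑ i : Fin k, ‖coeffF (Pi.single i 1 : Fin k → ℕ)‖ *
              r ^ (∑ j, (Pi.single i 1 : Fin k → ℕ) j) :=
            sum_image_le_of_nonneg fun _ _ => by positivity
        _ = k * r := by
            have : ∀ i : Fin k, ∑ j, (Pi.single i 1 : Fin k → ℕ) j = 1 := fun i =>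
              sum_eq_one_iff.2 ⟨i, rfl⟩
            simp [this, coeffF_of_sum_le_one (this _).le]
    have h2 : ∑ m ∈ ((Iic (fun _ : Fin k => N + 1)).filter
        (fun m => m ≠ 0 ∧ ∑ i, m i ≤ N + 1)).filter (fun m => ¬ ∑ i, m i = 1),
        ‖coeffF m‖ * r ^ (∑ i, m i) ≤ 1 / 4 := by
      calc _ ≤ ∑ m ∈ ((Iic (fun _ : Fin k => N + 1)).filter
            (fun m => m ≠ 0 ∧ ∑ i, m i ≤ N + 1)).filter (fun m => ¬ ∑ i, m i = 1),
            ∑ m' ∈ Ioo 0 m, (‖coeffF m'‖ * r ^ (∑ i, m' i)) *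
              (‖coeffF (m - m')‖ * r ^ (∑ i, (m - m') i)) := by
            refine sum_le_sum fun m hm => ?_
            rw [mem_filter, mem_filter] at hm
            have hs0 : ∑ i, m i ≠ 0 := fun h => hm.1.2.1 <| funext fun i =>
              (sum_eq_zero_iff.1 h) i (mem_univ i)
            refine (mul_le_mul_of_nonneg_right (norm_coeffF_le (by omega))
              (by positivity)).trans_eq ?_
            rw [sum_mul]
            refine sum_congr rfl fun m' hm' => ?_
            have hsplit : ∑ i, m i = ∑ i, m' i + ∑ i, (m - m') i := by
              rw [← sum_add_distrib]
              exact sum_congr rfl fun i _ =>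
                (add_tsub_cancel_of_le ((mem_Ioo.1 hm').2.le i)).symm
            rw [hsplit, pow_add]
            ring
        _ ≤ ∑ p ∈ I ×ˢ I, (‖coeffF p.1‖ * r ^ (∑ i, p.1 i)) *
              (‖coeffF p.2‖ * r ^ (∑ i, p.2 i)) := by
            rw [sum_sigma']
            have hadd : ∀ x ∈ (((Iic (fun _ : Fin k => N + 1)).filter
                (fun m => m ≠ 0 ∧ ∑ i, m i ≤ N + 1)).filter (fun m => ¬ ∑ i, m i = 1)).sigma
                (fun m => Ioo 0 m), x.2 + (x.1 - x.2) = x.1 := fun x hx =>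
              add_tsub_cancel_of_le (mem_Ioo.1 (mem_sigma.1 hx).2).2.le
            -- (m, m') ↦ (m', m - m') is injective with values in `I ×ˢ I`: both parts are nonzero,
            -- so each has total degree at most N.
            rw [← sum_image (f := fun p : (Fin k → ℕ) × (Fin k → ℕ) =>
              (‖coeffF p.1‖ * r ^ (∑ i, p.1 i)) * (‖coeffF p.2‖ * r ^ (∑ i, p.2 i)))
              (g := fun x : (_ : Fin k → ℕ) × (Fin k → ℕ) => (x.2, x.1 - x.2))]
            · refine sum_le_sum_of_subset_of_nonneg (fun p hp => ?_) fun _ _ _ => by positivity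
              obtain ⟨⟨m, m'⟩, hx, rfl⟩ := mem_image.1 hp
              have hm' := mem_Ioo.1 (mem_sigma.1 hx).2
              have hsum : ∑ i, m' i + ∑ i, (m - m') i = ∑ i, m i := by
                rw [← sum_add_distrib]
                exact sum_congr rfl fun i _ => congrFun (hadd _ hx) i
              have hm := (mem_filter.1 (mem_filter.1 (mem_sigma.1 hx).1).1).2.2
              have pos : ∀ u : Fin k → ℕ, u ≠ 0 → 0 < ∑ i, u i := fun u hu =>
                Nat.pos_of_ne_zero fun h => hu <| funext fun i =>
                  (sum_eq_zero_iff.1 h) i (mem_univ i)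
              have p1 : m' ≠ 0 := hm'.1.ne'
              have p2 : m - m' ≠ 0 := fun h => hm'.2.not_ge (tsub_eq_zero_iff_le.1 h)
              have q1 := pos _ p1
              have q2 := pos _ p2
              dsimp only at hm
              exact mem_product.2 ⟨memI m' p1 (by omega), memI (m - m') p2 (by omega)⟩
            · intro x hx y hy hxy
              have h1 := hadd x hx
              have h2 := hadd y hy
              obtain ⟨m, m'⟩ := x
              obtain ⟨u, u'⟩ := y
              simp only [Prod.mk.injEq] at hxy h1 h2
              obtain ⟨rfl, hxy⟩ := hxy
              rw [hxy] at h1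
              obtain rfl := h1.symm.trans h2
              rfl
        _ = (∑ m ∈ I, ‖coeffF m‖ * r ^ (∑ i, m i)) * ∑ m ∈ I, ‖coeffF m‖ * r ^ (∑ i, m i) := by
            rw [sum_mul_sum, sum_product]
        _ ≤ 1 / 2 * (1 / 2) := by
            refine mul_le_mul ih ih (sum_nonneg fun _ _ => by positivity) (by norm_num)
        _ = 1 / 4 := by norm_num
    linarith

theorem summable_norm_coeffF {r : ℝ} (hr : 0 ≤ r) (hkr : k * r ≤ 1 / 4) :
    Summable fun m : Fin k → ℕ => ‖coeffF m‖ * r ^ (∑ i, m i) := by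
  refine summable_of_sum_le (c := 1 + 1 / 2) (fun _ => by positivity) fun u => ?_
  set N := ∑ m ∈ u, ∑ i, m i
  have hu : u ⊆ insert 0 ((Iic (fun _ : Fin k => N)).filter (fun m => m ≠ 0 ∧ ∑ i, m i ≤ N)) := by
    intro m hm
    have hN : ∑ i, m i ≤ N :=
      single_le_sum (f := fun m : Fin k → ℕ => ∑ i, m i) (fun _ _ => Nat.zero_le _) hm
    rw [mem_insert, mem_filter, mem_Iic]
    by_cases h0 : m = 0
    · exact Or.inl h0
    · exact Or.inr ⟨fun i =>
        (single_le_sum (f := m) (fun _ _ => Nat.zero_le _) (mem_univ i)).trans hN, h0, hN⟩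
  refine (sum_le_sum_of_subset_of_nonneg hu fun _ _ _ => by positivity).trans ?_
  rw [sum_insert (by simp)]
  refine add_le_add ?_ (sum_norm_coeffF_le hr hkr N)
  simp

end Coefficients

/-! ### Uniqueness of the graded solution of the recursion. -/

section WeightExpansion

variable {k : ℕ}

/-- The multi-indices of a given weight. -/
def multiIndices (k N : ℕ) : Finset (Fin k → ℕ) :=
  (Iic fun _ => N).filter fun m => weight m = N

theorem mem_multiIndices {N : ℕ} {m : Fin k → ℕ} : m ∈ multiIndices k N ↔ weight m = N := by
  rw [multiIndices, mem_filter, mem_Iic, and_iff_right_iff_imp]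
  rintro rfl i
  exact le_weight m i

theorem prod_pow_single {R : Type*} [CommMonoid R] (t : Fin k → R) (i : Fin k) :
    ∏ j, t j ^ (Pi.single i 1 : Fin k → ℕ) j = t i := by
  rw [prod_eq_single i (fun j _ hj => by rw [Pi.single_eq_of_ne hj, pow_zero]) (by simp),
    Pi.single_eq_same, pow_one]

/-- A graded element of a commutative algebra that satisfies the quadratic recursion of the
coefficients of `F` is given by the expansion of `F`. -/
theorem eq_sum_coeffF_of_recursion {R : Type*} [CommRing R] [Algebra ℂ R] {A : ℕ → R}
    {t : Fin k → R} (h0 : A 0 = 1)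
    (hA : ∀ N : ℕ, ∑ p ∈ antidiagonal N, ((-1) ^ p.2 * (p.1 : ℂ)) • (A p.1 * A p.2) =
      ∑ i : Fin k, if (i : ℕ) + 1 = N then (N : ℂ) • t i else 0) (N : ℕ) :
    A N = ∑ m ∈ multiIndices k N, coeffF m • ∏ i, t i ^ m i := by
  obtain ⟨B, hB⟩ : ∃ B : ℕ → R, ∀ N, B N = ∑ m ∈ multiIndices k N, coeffF m • ∏ i, t i ^ m i :=
    ⟨_, fun _ => rfl⟩
  have hB0 : B 0 = 1 := by
    have : multiIndices k 0 = {0} := by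
      ext m
      rw [mem_multiIndices, weight_eq_zero_iff, mem_singleton]
    rw [hB, this, sum_singleton]
    simp
  have hBrec : ∀ N : ℕ, ∑ p ∈ antidiagonal N, ((-1) ^ p.2 * (p.1 : ℂ)) • (B p.1 * B p.2) =
      ∑ i : Fin k, if (i : ℕ) + 1 = N then (N : ℂ) • t i else 0 := by
    intro N
    have e1 : ∀ p ∈ antidiagonal N, ((-1) ^ p.2 * (p.1 : ℂ)) • (B p.1 * B p.2) =
        ∑ q ∈ multiIndices k p.1 ×ˢ multiIndices k p.2,
          ((-1) ^ weight q.2 * (weight q.1 : ℂ) * (coeffF q.1 * coeffF q.2)) •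
            ∏ i, t i ^ (q.1 + q.2) i := by
      intro p _
      rw [hB, hB, sum_mul_sum, ← sum_product', smul_sum]
      refine sum_congr rfl fun q hq => ?_
      rw [mem_product, mem_multiIndices, mem_multiIndices] at hq
      rw [hq.1, hq.2, smul_mul_smul_comm, smul_smul, ← prod_mul_distrib]
      simp only [Pi.add_apply, pow_add]
    rw [sum_congr rfl e1]
    have e2 : ∑ i : Fin k, (if (i : ℕ) + 1 = N then (N : ℂ) • t i else 0) =
        ∑ m ∈ multiIndices k N, (if ∑ i, m i = 1 then (weight m : ℂ) else 0) •
          ∏ i, t i ^ m i := by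
      simp only [ite_smul, zero_smul]
      rw [← sum_filter, ← sum_filter]
      refine sum_bij (fun i _ => Pi.single i 1) ?_ ?_ ?_ ?_
      · intro i hi
        rw [mem_filter, mem_multiIndices, weight_single]
        exact ⟨(mem_filter.1 hi).2, sum_eq_one_iff.2 ⟨i, rfl⟩⟩
      · intro i _ j _ hij
        by_contra hne
        have := congrFun hij i
        simp [Pi.single_eq_of_ne hne] at this
      · intro m hm
        rw [mem_filter, mem_multiIndices] at hm
        obtain ⟨i, rfl⟩ := sum_eq_one_iff.1 hm.2
        exact ⟨i, by simpa [weight_single] using hm.1, rfl⟩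
      · intro i hi
        rw [prod_pow_single, weight_single, (mem_filter.1 hi).2]
    rw [e2]
    simp only [← sum_antidiagonal_coeffF, sum_smul]
    rw [sum_sigma', sum_sigma']
    -- Both sides run over the pairs of multi-indices of total weight N, grouped by the two weights
    -- or by the sum.
    refine sum_bij' (fun x _ => ⟨x.2.1 + x.2.2, x.2⟩)
      (fun x _ => ⟨(weight x.2.1, weight x.2.2), x.2⟩) ?_ ?_ ?_ ?_ ?_
    · rintro ⟨p, q⟩ hx
      simp only [mem_sigma, HasAntidiagonal.mem_antidiagonal, mem_product, mem_multiIndices] at hx ⊢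
      simp only [weight_add, hx.2.1, hx.2.2, hx.1, and_self]
    · rintro ⟨m, q⟩ hx
      simp only [mem_sigma, HasAntidiagonal.mem_antidiagonal, mem_product, mem_multiIndices] at hx ⊢
      simp only [← weight_add, hx.2, hx.1, and_self]
    · rintro ⟨p, q⟩ hx
      simp only [mem_sigma, HasAntidiagonal.mem_antidiagonal, mem_product, mem_multiIndices] at hx
      simp only [hx.2.1, hx.2.2]
    · rintro ⟨m, q⟩ hx
      simp only [mem_sigma, HasAntidiagonal.mem_antidiagonal, mem_multiIndices] at hx
      simp only [hx.2]
    · rintro ⟨p, q⟩ _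
      rfl
  rw [← hB]
  induction N using Nat.strong_induction_on with
  | _ N ih =>
    by_cases hN : N = 0
    · rw [hN, h0, hB0]
    · have h1 := (hA N).trans (hBrec N).symm
      have hmem : (N, 0) ∈ antidiagonal N := by simp
      rw [← add_sum_erase _ _ hmem, ← add_sum_erase _ _ hmem] at h1
      have h2 : ∑ p ∈ (antidiagonal N).erase (N, 0),
          ((-1) ^ p.2 * (p.1 : ℂ)) • (A p.1 * A p.2) =
          ∑ p ∈ (antidiagonal N).erase (N, 0),
          ((-1) ^ p.2 * (p.1 : ℂ)) • (B p.1 * B p.2) := by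
        refine sum_congr rfl fun p hp => ?_
        rw [mem_erase, HasAntidiagonal.mem_antidiagonal, Ne, Prod.ext_iff] at hp
        by_cases hp1 : p.1 = 0
        · simp [hp1]
        · rw [ih p.1 (by omega), ih p.2 (by omega)]
      rw [h2, add_left_inj] at h1
      simp only [pow_zero, one_mul, h0, hB0, mul_one] at h1
      exact smul_right_injective R (Nat.cast_ne_zero.2 hN : (N : ℂ) ≠ 0) h1

end WeightExpansion

/-! ### The commutative algebra of excitations and the recursion for the state. -/

section ExcitationAlgebra

variable {l : ℕ}

/-- The pairs `(P, Q)` with `P ⊆ G`, `Q ⊆ [l] ∖ G` and `|P| = |Q|`. -/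
def excitePairs (G : Finset (Fin l)) : Finset (Finset (Fin l) × Finset (Fin l)) :=
  (G.powerset ×ˢ Gᶜ.powerset).filter fun e => e.1.card = e.2.card

theorem mem_excitePairs {G : Finset (Fin l)} {e : Finset (Fin l) × Finset (Fin l)} :
    e ∈ excitePairs G ↔ e.1 ⊆ G ∧ Disjoint G e.2 ∧ e.1.card = e.2.card := by
  rw [excitePairs, mem_filter, mem_product, mem_powerset, mem_powerset, and_assoc,
    subset_compl_iff_disjoint_left]

/-- The linear combination of the excitations of `G` with coefficients `a`. -/
noncomputable def exciteSum (G : Finset (Fin l)) (a : Finset (Fin l) → Finset (Fin l) → ℂ) :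
    Module.End ℂ (Fock l) :=
  ∑ e ∈ excitePairs G, a e.1 e.2 • excite G e.1 e.2

/-- The product of the coefficients of two combinations of excitations. -/
noncomputable def exciteConv (a b : Finset (Fin l) → Finset (Fin l) → ℂ)
    (P Q : Finset (Fin l)) : ℂ :=
  ∑ P' ∈ P.powerset, ∑ Q' ∈ Q.powerset.filter (fun Q' => Q'.card = P'.card),
    sgn (P \ P') P' * sgn Q' (Q \ Q') * (a P' Q' * b (P \ P') (Q \ Q'))

theorem exciteSum_congr {G : Finset (Fin l)} {a b : Finset (Fin l) → Finset (Fin l) → ℂ}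
    (h : ∀ e ∈ excitePairs G, a e.1 e.2 = b e.1 e.2) : exciteSum G a = exciteSum G b :=
  sum_congr rfl fun e he => by rw [h e he]

/-- Only disjoint pairs multiply to something nonzero, and two disjoint pairs amount to their union
with the first pair marked inside it. -/
theorem exciteSum_mul (G : Finset (Fin l)) (a b : Finset (Fin l) → Finset (Fin l) → ℂ) :
    exciteSum G a * exciteSum G b = exciteSum G (exciteConv a b) := by
  have hL : exciteSum G a * exciteSum G b =
      ∑ x ∈ (excitePairs G ×ˢ excitePairs G).filter
        (fun x => Disjoint x.1.1 x.2.1 ∧ Disjoint x.1.2 x.2.2),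
        (sgn x.2.1 x.1.1 * sgn x.1.2 x.2.2 * (a x.1.1 x.1.2 * b x.2.1 x.2.2)) •
          excite G (x.1.1 ∪ x.2.1) (x.1.2 ∪ x.2.2) := by
    rw [exciteSum, exciteSum, sum_mul_sum, ← sum_product', sum_filter]
    refine sum_congr rfl fun x hx => ?_
    rw [mem_product, mem_excitePairs, mem_excitePairs] at hx
    rw [smul_mul_smul_comm,
      excite_mul hx.1.1 hx.2.1 hx.1.2.1 hx.2.2.1 hx.1.2.2 hx.2.2.2]
    split_ifs
    · rw [smul_smul, mul_comm]
    · rw [smul_zero]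
  have hR : exciteSum G (exciteConv a b) =
      ∑ x ∈ (excitePairs G).sigma (fun e => (e.1.powerset ×ˢ e.2.powerset).filter
        (fun f => f.2.card = f.1.card)),
        (sgn (x.1.1 \ x.2.1) x.2.1 * sgn x.2.2 (x.1.2 \ x.2.2) *
          (a x.2.1 x.2.2 * b (x.1.1 \ x.2.1) (x.1.2 \ x.2.2))) • excite G x.1.1 x.1.2 := by
    rw [exciteSum, sum_sigma]
    refine sum_congr rfl fun e _ => ?_
    simp only [exciteConv, sum_filter, sum_product, sum_smul, ite_smul, zero_smul]
  rw [hL, hR]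
  refine sum_bij' (fun x _ => ⟨(x.1.1 ∪ x.2.1, x.1.2 ∪ x.2.2), x.1⟩)
    (fun x _ => (x.2, (x.1.1 \ x.2.1, x.1.2 \ x.2.2))) ?_ ?_ ?_ ?_ ?_
  · rintro ⟨⟨P, Q⟩, ⟨P', Q'⟩⟩ hx
    simp only [mem_filter, mem_product, mem_excitePairs, mem_sigma, mem_powerset] at hx ⊢
    obtain ⟨⟨⟨h1, h2, h3⟩, h4, h5, h6⟩, h7, h8⟩ := hx
    refine ⟨⟨union_subset h1 h4, disjoint_union_right.2 ⟨h2, h5⟩, ?_⟩,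
      ⟨subset_union_left, subset_union_left⟩, h3.symm⟩
    rw [card_union_of_disjoint h7, card_union_of_disjoint h8, h3, h6]
  · rintro ⟨⟨P, Q⟩, ⟨P', Q'⟩⟩ hx
    simp only [mem_filter, mem_product, mem_excitePairs, mem_sigma, mem_powerset] at hx ⊢
    obtain ⟨⟨h1, h2, h3⟩, ⟨h4, h5⟩, h6⟩ := hx
    refine ⟨⟨⟨h4.trans h1, h2.mono_right h5, h6.symm⟩, sdiff_subset.trans h1,
      h2.mono_right sdiff_subset, ?_⟩, disjoint_sdiff, disjoint_sdiff⟩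
    rw [card_sdiff_of_subset h4, card_sdiff_of_subset h5, h3, h6]
  · rintro ⟨⟨P, Q⟩, ⟨P', Q'⟩⟩ hx
    simp only [mem_filter] at hx
    simp only [union_sdiff_cancel_left hx.2.1, union_sdiff_cancel_left hx.2.2]
  · rintro ⟨⟨P, Q⟩, ⟨P', Q'⟩⟩ hx
    simp only [mem_filter, mem_product, mem_sigma, mem_powerset] at hx
    simp only [union_sdiff_of_subset hx.2.1.1, union_sdiff_of_subset hx.2.1.2]
  · rintro ⟨⟨P, Q⟩, ⟨P', Q'⟩⟩ hx
    simp only [mem_filter] at hx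
    simp only [union_sdiff_cancel_left hx.2.1, union_sdiff_cancel_left hx.2.2]

/-- Exchanging the factors costs (-1)^{|P||P'|} once for the P-sets and once for the Q-sets. -/
theorem excite_commute {G : Finset (Fin l)} {e f : Finset (Fin l) × Finset (Fin l)}
    (he : e ∈ excitePairs G) (hf : f ∈ excitePairs G) :
    Commute (excite G e.1 e.2) (excite G f.1 f.2) := by
  rw [mem_excitePairs] at he hf
  rw [Commute, SemiconjBy, excite_mul he.1 hf.1 he.2.1 hf.2.1 he.2.2 hf.2.2,
    excite_mul hf.1 he.1 hf.2.1 he.2.1 hf.2.2 he.2.2]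
  by_cases hd : Disjoint e.1 f.1 ∧ Disjoint e.2 f.2
  · rw [if_pos hd, if_pos ⟨hd.1.symm, hd.2.symm⟩, union_comm f.1, union_comm f.2,
      sgn_swap hd.1, sgn_swap hd.2, he.2.2, hf.2.2]
    congr 1
    ring
  · rw [if_neg hd, if_neg fun h => hd ⟨h.1.symm, h.2.symm⟩]

theorem excite_mul_self {G : Finset (Fin l)} {e : Finset (Fin l) × Finset (Fin l)}
    (he : e ∈ excitePairs G) (hne : e.1.Nonempty) :
    excite G e.1 e.2 * excite G e.1 e.2 = 0 := by
  rw [mem_excitePairs] at he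
  rw [excite_mul he.1 he.1 he.2.1 he.2.1 he.2.2 he.2.2, if_neg]
  exact fun h => hne.ne_empty (disjoint_self.1 h.1)

theorem excite_empty (G : Finset (Fin l)) : excite G ∅ ∅ = 1 := by
  simp [excite, creMonomial, annMonomial]

theorem cre_mul_ann_eq_excite (G P Q : Finset (Fin l)) :
    creMonomial Q * annMonomial P = sgn (G \ P) P • excite G P Q := by
  rw [excite, smul_smul, sgn_mul_self, one_smul]

theorem Excitation.mem_excitePairs {G : Finset (Fin l)} {k : ℕ} (e : Excitation G k) :
    e.1 ∈ excitePairs G := by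
  rw [Fermion.mem_excitePairs, ← subset_compl_iff_disjoint_left]
  exact ⟨e.2.1, e.2.2.1, e.2.2.2.1⟩

variable {k : ℕ}

theorem excOp_commute (G : Finset (Fin l)) (θ : Excitation G k → ℂ) (i j : Fin k) :
    Commute (excOp G θ i) (excOp G θ j) := by
  refine Commute.sum_left _ _ _ fun e _ => Commute.sum_right _ _ _ fun f _ => ?_
  rw [cre_mul_ann_eq_excite G, cre_mul_ann_eq_excite G]
  exact ((((excite_commute e.mem_excitePairs f.mem_excitePairs).smul_left _).smul_left
    _).smul_right _).smul_right _

theorem excOp_isNilpotent (G : Finset (Fin l)) (θ : Excitation G k → ℂ) (i : Fin k) :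
    IsNilpotent (excOp G θ i) := by
  refine Commute.isNilpotent_sum (fun e _ => ?_) fun e f _ _ => ?_
  · refine ⟨2, ?_⟩
    have hne : e.1.1.Nonempty := card_pos.1 e.2.2.2.2.1
    rw [cre_mul_ann_eq_excite G, sq, smul_smul, smul_mul_smul_comm,
      excite_mul_self e.mem_excitePairs hne, smul_zero]
  · rw [cre_mul_ann_eq_excite G, cre_mul_ann_eq_excite G]
    exact ((((excite_commute e.mem_excitePairs f.mem_excitePairs).smul_left _).smul_left
      _).smul_right _).smul_right _

/-- The sign σ(G ∖ P, P) in θ is the normalisation of `excite`, so the connected amplitudes are the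
coefficients in the normalised excitations. -/
theorem excOp_theta (G : Finset (Fin l)) (v : Fock l) (i : Fin k) :
    excOp G (theta G k v) i =
      exciteSum G fun P Q => if P.card = (i : ℕ) + 1 then connAmp G v P Q else 0 := by
  rw [excOp, exciteSum]
  simp only [ite_smul, zero_smul]
  rw [← sum_filter]
  refine sum_bij (fun e _ => e.1) ?_ ?_ ?_ ?_
  · intro e he
    exact mem_filter.2 ⟨e.mem_excitePairs, (mem_filter.1 he).2⟩
  · intro e _ f _ h
    exact Subtype.ext h
  · intro e he
    rw [mem_filter, mem_excitePairs, ← subset_compl_iff_disjoint_left] at he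
    refine ⟨⟨e, he.1.1, he.1.2.1, he.1.2.2, by omega, ?_⟩, by simp [he.2], rfl⟩
    have := i.2
    omega
  · intro e _
    rw [theta, excite, smul_smul]

/-- The part of `|v⟩ / v(G)` of excitation order `N`, as an operator. -/
noncomputable def ampOp (G : Finset (Fin l)) (v : Fock l) (N : ℕ) : Module.End ℂ (Fock l) :=
  exciteSum G fun P Q => if P.card = N then relAmp G v P Q else 0

theorem ampOp_zero {G : Finset (Fin l)} {v : Fock l} (hv : v G ≠ 0) : ampOp G v 0 = 1 := by
  rw [ampOp, exciteSum, sum_eq_single (∅, ∅)]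
  · simp [relAmp_empty hv, excite_empty]
  · rintro ⟨P, Q⟩ he hne
    rw [mem_excitePairs] at he
    rw [if_neg, zero_smul]
    intro h0
    apply hne
    exact Prod.ext (card_eq_zero.1 h0) (card_eq_zero.1 (he.2.2.symm.trans h0))
  · intro h
    exact absurd (mem_excitePairs.2 (by simp)) h

theorem smul_exciteSum (G : Finset (Fin l)) (c : ℂ) (a : Finset (Fin l) → Finset (Fin l) → ℂ) :
    c • exciteSum G a = exciteSum G fun P Q => c * a P Q := by
  simp only [exciteSum, smul_sum, smul_smul]

theorem sum_exciteSum {ι : Type*} (s : Finset ι) (G : Finset (Fin l))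
    (a : ι → Finset (Fin l) → Finset (Fin l) → ℂ) :
    ∑ i ∈ s, exciteSum G (a i) = exciteSum G fun P Q => ∑ i ∈ s, a i P Q := by
  simp only [exciteSum, sum_smul]
  exact sum_comm

/-- The equation A'(μ) A(-μ) = ∑_j j T_j μ^{j-1}, compared coefficientwise at each excitation. It
holds by definition of the connected amplitudes if T_j is kept for all j; Ω^k removes those with j >
k. -/
theorem ampOp_recursion {G : Finset (Fin l)} {v : Fock l} (hv : v G ≠ 0)
    (hΩ : (Omega l ^ k) (TensorProduct.tmul ℂ v v) = 0) (N : ℕ) :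
    ∑ p ∈ antidiagonal N, ((-1) ^ p.2 * (p.1 : ℂ)) • (ampOp G v p.1 * ampOp G v p.2) =
      ∑ i : Fin k, if (i : ℕ) + 1 = N then (N : ℂ) • excOp G (theta G k v) i else 0 := by
  have hL : ∀ p ∈ antidiagonal N,
      ((-1) ^ p.2 * (p.1 : ℂ)) • (ampOp G v p.1 * ampOp G v p.2) =
      exciteSum G fun P Q => ((-1) ^ p.2 * (p.1 : ℂ)) * exciteConv
        (fun P Q => if P.card = p.1 then relAmp G v P Q else 0)
        (fun P Q => if P.card = p.2 then relAmp G v P Q else 0) P Q := fun p _ => by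
    rw [ampOp, ampOp, exciteSum_mul, smul_exciteSum]
  have hR : ∀ i ∈ (univ : Finset (Fin k)),
      (if (i : ℕ) + 1 = N then (N : ℂ) • excOp G (theta G k v) i else 0) =
      exciteSum G fun P Q => if (i : ℕ) + 1 = N ∧ P.card = N then (N : ℂ) * connAmp G v P Q
        else 0 := fun i _ => by
    rw [excOp_theta, smul_exciteSum]
    split_ifs with h
    · subst h
      simp
    · simp [h, exciteSum]
  rw [sum_congr rfl hL, sum_congr rfl hR, sum_exciteSum, sum_exciteSum]
  refine exciteSum_congr ?_
  rintro ⟨P, Q⟩ he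
  rw [mem_excitePairs] at he
  dsimp only at he ⊢
  -- Only the splitting p = (|P'|, |P ∖ P'|) survives the indicator functions.
  have key : ∀ P' ∈ P.powerset, ∀ Q', ∑ p ∈ antidiagonal N, ((-1) ^ p.2 * (p.1 : ℂ)) *
      (sgn (P \ P') P' * sgn Q' (Q \ Q') * ((if P'.card = p.1 then relAmp G v P' Q' else 0) *
        if (P \ P').card = p.2 then relAmp G v (P \ P') (Q \ Q') else 0)) =
      if P.card = N then (P'.card : ℂ) * ampProd G v P Q P' Q' else 0 := by
    intro P' hP' Q'
    have hcard : P'.card + (P \ P').card = P.card := by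
      rw [add_comm, card_sdiff_add_card_eq_card (mem_powerset.1 hP')]
    by_cases hN : P.card = N
    · rw [if_pos hN, sum_eq_single (P'.card, (P \ P').card)]
      · simp only [if_true, ampProd]
        ring
      · rintro ⟨i, j⟩ _ hne
        by_cases h1 : P'.card = i
        · have h2 : (P \ P').card ≠ j := fun h2 => hne (by rw [h1, h2])
          simp [h2]
        · simp [h1]
      · intro h
        exact absurd (HasAntidiagonal.mem_antidiagonal.2 (by dsimp only; omega)) h
    · rw [if_neg hN]
      refine sum_eq_zero ?_
      rintro ⟨i, j⟩ hij
      rw [HasAntidiagonal.mem_antidiagonal] at hij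
      by_cases h1 : P'.card = i
      · have h2 : (P \ P').card ≠ j := by dsimp only at hij; omega
        simp [h2]
      · simp [h1]
  have hLHS : ∑ p ∈ antidiagonal N, ((-1) ^ p.2 * (p.1 : ℂ)) * exciteConv
      (fun P Q => if P.card = p.1 then relAmp G v P Q else 0)
      (fun P Q => if P.card = p.2 then relAmp G v P Q else 0) P Q =
      if P.card = N then (P.card : ℂ) * connAmp G v P Q else 0 := by
    simp only [exciteConv, mul_sum]
    rw [sum_comm]
    have : ∀ P' ∈ P.powerset, (∑ p ∈ antidiagonal N,
        ∑ Q' ∈ Q.powerset.filter (fun Q' => Q'.card = P'.card), ((-1) ^ p.2 * (p.1 : ℂ)) *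
      (sgn (P \ P') P' * sgn Q' (Q \ Q') * ((if P'.card = p.1 then relAmp G v P' Q' else 0) *
        if (P \ P').card = p.2 then relAmp G v (P \ P') (Q \ Q') else 0))) =
        ∑ Q' ∈ Q.powerset.filter (fun Q' => Q'.card = P'.card),
          if P.card = N then (P'.card : ℂ) * ampProd G v P Q P' Q' else 0 := by
      intro P' hP'
      rw [sum_comm]
      exact sum_congr rfl fun Q' _ => key P' hP' Q'
    rw [sum_congr rfl this]
    by_cases hN : P.card = N
    · simp only [if_pos hN]
      by_cases h0 : P.card = 0
      · rw [card_eq_zero] at h0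
        subst h0
        simp
      · rw [card_mul_connAmp hv he.2.2 (by omega)]
    · simp [hN]
  rw [hLHS]
  by_cases hN : P.card = N
  · subst hN
    simp only [if_true, and_true]
    by_cases hkP : k < P.card
    · rw [connAmp_eq_zero hv hΩ he.1 he.2.1 he.2.2 hkP]
      simp
    · by_cases h0 : P.card = 0
      · simp [h0]
      · rw [sum_eq_single (⟨P.card - 1, by omega⟩ : Fin k)]
        · rw [if_pos (by dsimp only; omega)]
        · intro i _ hi
          rw [if_neg]
          intro h
          exact hi (Fin.ext (by dsimp only; omega))
        · simp
  · simp [hN]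

/-- The amplitude expansion of `|v⟩` about the reference `G`. -/
theorem sum_ampOp_ket {G : Finset (Fin l)} {v : Fock l} (hv : v G ≠ 0)
    (hn : ∀ S : Finset (Fin l), S.card ≠ G.card → v S = 0) {M : ℕ} (hM : G.card < M) :
    v G • (∑ N ∈ range M, ampOp G v N) (ket G) = v := by
  have hsum : ∑ N ∈ range M, ampOp G v N = exciteSum G (relAmp G v) := by
    simp only [ampOp]
    rw [sum_exciteSum]
    refine exciteSum_congr fun e he => ?_
    have := card_le_card (mem_excitePairs.1 he).1
    rw [sum_ite_eq, if_pos (mem_range.2 (by omega))]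
  have hterm : ∀ e ∈ excitePairs G, v G • (relAmp G v e.1 e.2 • excite G e.1 e.2) (ket G) =
      v (G \ e.1 ∪ e.2) • ket (G \ e.1 ∪ e.2) := by
    intro e he
    rw [mem_excitePairs] at he
    rw [LinearMap.smul_apply, excite_ket he.1 he.2.1, smul_smul, smul_smul, relAmp]
    congr 1
    field_simp
    rw [sgn_sq, one_mul]
  rw [hsum, exciteSum, LinearMap.sum_apply, smul_sum, sum_congr rfl hterm]
  have hv' : v = ∑ S : Finset (Fin l), v S • ket S := by
    funext U
    simp [ket, Finset.sum_apply, Pi.single_apply]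
  conv_rhs => rw [hv']
  rw [← sum_filter_add_sum_filter_not univ (fun S : Finset (Fin l) => S.card = G.card),
    sum_eq_zero (s := univ.filter (fun S : Finset (Fin l) => ¬ S.card = G.card)), add_zero]
  -- Each `S` of size |G| arises from `G` by exactly one excitation.
  · refine sum_bij' (fun e _ => G \ e.1 ∪ e.2) (fun S _ => (G \ S, S \ G)) ?_ ?_ ?_ ?_ ?_
    · intro e he
      rw [mem_excitePairs] at he
      rw [mem_filter]
      refine ⟨mem_univ _, ?_⟩
      rw [card_union_of_disjoint (he.2.1.mono_left sdiff_subset), card_sdiff_of_subset he.1]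
      have := card_le_card he.1
      omega
    · intro S hS
      rw [mem_filter] at hS
      rw [mem_excitePairs]
      refine ⟨sdiff_subset, disjoint_sdiff, ?_⟩
      exact (card_sdiff_comm hS.2.symm)
    · rintro ⟨P, Q⟩ he
      rw [mem_excitePairs] at he
      refine Prod.ext ?_ ?_
      · ext x
        have h1 : x ∈ P → x ∈ G := fun hx => he.1 hx
        have h2 : x ∈ G → x ∉ Q := fun hx => disjoint_left.1 he.2.1 hx
        simp only [mem_sdiff, mem_union]
        tauto
      · ext x
        have h2 : x ∈ G → x ∉ Q := fun hx => disjoint_left.1 he.2.1 hx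
        simp only [mem_sdiff, mem_union]
        tauto
    · intro S _
      ext x
      simp only [mem_sdiff, mem_union]
      tauto
    · intro e _
      rfl
  · intro S hS
    rw [hn S (mem_filter.1 hS).2, zero_smul]

end ExcitationAlgebra

/-! ### Substitution into the expansion, and the parameter count. -/

section Representation

variable {l k : ℕ}

-- The uniqueness result needs a commutative ring, so it is applied in the subalgebra generated by
-- the excitations of `G`, and the identity is then mapped back to the endomorphisms.
open scoped IsMulCommutative in
theorem ampOp_eq_sum_coeffF {G : Finset (Fin l)} {v : Fock l} (hv : v G ≠ 0)
    (hΩ : (Omega l ^ k) (TensorProduct.tmul ℂ v v) = 0) (N : ℕ) :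
    ampOp G v N = ∑ m ∈ multiIndices k N,
      coeffF m • (List.ofFn fun i => excOp G (theta G k v) i ^ m i).prod := by
  obtain ⟨S, hS⟩ : ∃ S : Set (Module.End ℂ (Fock l)),
    S = (fun e : Finset (Fin l) × Finset (Fin l) => excite G e.1 e.2) ''
      (excitePairs G : Set (Finset (Fin l) × Finset (Fin l))) := ⟨_, rfl⟩
  have hcomm : ∀ a ∈ S, ∀ b ∈ S, a * b = b * a := by
    rw [hS]
    rintro _ ⟨e, he, rfl⟩ _ ⟨f, hf, rfl⟩
    exact excite_commute (mem_coe.1 he) (mem_coe.1 hf)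
  have := Algebra.isMulCommutative_adjoin ℂ hcomm
  have hmem : ∀ a, exciteSum G a ∈ Algebra.adjoin ℂ S := fun a =>
    Subalgebra.sum_mem _ fun e he => Subalgebra.smul_mem _
      (Algebra.subset_adjoin (hS ▸ Set.mem_image_of_mem _ (mem_coe.2 he))) _
  have hT : ∀ i, excOp G (theta G k v) i ∈ Algebra.adjoin ℂ S := fun i => by
    rw [excOp_theta]
    exact hmem _
  have h := eq_sum_coeffF_of_recursion (R := Algebra.adjoin ℂ S)
    (A := fun N => ⟨ampOp G v N, hmem _⟩) (t := fun i => ⟨_, hT i⟩)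
    (Subtype.ext (ampOp_zero hv)) (fun N => Subtype.ext ?_) N
  · have h' := congrArg (Algebra.adjoin ℂ S).val h
    rw [map_sum] at h'
    refine h'.trans (sum_congr rfl fun m _ => ?_)
    rw [map_smul, ← List.prod_ofFn, map_list_prod, List.map_ofFn]
    rfl
  · have h' := ampOp_recursion hv hΩ N
    refine Eq.trans ?_ (h'.trans ?_)
    · change (Algebra.adjoin ℂ S).val _ = _
      rw [map_sum]
      rfl
    · change _ = (Algebra.adjoin ℂ S).val _
      rw [map_sum]
      refine sum_congr rfl fun i _ => ?_
      split_ifs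
      · rfl
      · rfl

/-- A state of `𝒢_k` is obtained by applying the expansion of `F` to a reference state. -/
theorem eq_opEval_of_taylorCoeff {f : (Fin k → ℂ) → ℂ} (hf : ∀ m, taylorCoeff f m = coeffF m)
    {G : Finset (Fin l)} {v : Fock l} (hv : v G ≠ 0)
    (hn : ∀ S : Finset (Fin l), S.card ≠ G.card → v S = 0)
    (hΩ : (Omega l ^ k) (TensorProduct.tmul ℂ v v) = 0) :
    v = v G • opEval f (excOp G (theta G k v)) (ket G) := by
  obtain ⟨T, hT⟩ : ∃ T, T = excOp G (theta G k v) := ⟨_, rfl⟩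
  obtain ⟨L, hL⟩ : ∃ L, ∀ i, T i ^ L = 0 := by
    choose L hL using fun i => excOp_isNilpotent G (theta G k v) i
    refine ⟨∑ i, L i, fun i => ?_⟩
    rw [hT]
    exact pow_eq_zero_of_le (single_le_sum (fun _ _ => Nat.zero_le _) (mem_univ i)) (hL i)
  -- A multi-index of weight at least `M` has an exponent ≥ `L`, so its monomial vanishes; and `M >
  -- G.card` keeps every excitation order.
  obtain ⟨M, hM⟩ : ∃ M, M = weight (fun _ : Fin k => L) + G.card + 1 := ⟨_, rfl⟩
  have hsupp : Function.support (fun m : Fin k → ℕ =>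
      taylorCoeff f m • (List.ofFn fun i => T i ^ m i).prod) ⊆
      ((range M).biUnion (multiIndices k) : Finset (Fin k → ℕ)) := by
    intro m hm
    rw [mem_coe, mem_biUnion]
    refine ⟨weight m, mem_range.2 ?_, mem_multiIndices.2 rfl⟩
    by_contra hlt
    apply hm
    obtain ⟨i, hi⟩ : ∃ i, L ≤ m i := by
      by_contra! hcon
      have := weight_mono (m := m) (m' := fun _ => L) fun i => (hcon i).le
      omega
    have h0 : (List.ofFn fun i => T i ^ m i).prod = 0 := by
      refine List.prod_eq_zero (List.mem_ofFn.2 ⟨i, pow_eq_zero_of_le hi (hL i)⟩)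
    simp only [h0, smul_zero]
  have heval : opEval f T = ∑ N ∈ range M, ampOp G v N := by
    rw [opEval, finsum_eq_sum_of_support_subset _ hsupp, sum_biUnion]
    · refine sum_congr rfl fun N _ => ?_
      rw [ampOp_eq_sum_coeffF hv hΩ, hT]
      simp only [hf]
    · intro N _ N' _ hne
      refine disjoint_left.2 fun m hm hm' => hne ?_
      rw [mem_multiIndices] at hm hm'
      exact hm.symm.trans hm'
  rw [← hT, heval, sum_ampOp_ket hv hn (by omega)]

theorem card_excitation {n : ℕ} {G : Finset (Fin l)} (hG : G.card = n) :
    Fintype.card (Excitation G k) = ∑ j ∈ Icc 1 k, n.choose j * (l - n).choose j := by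
  have hGc : Gᶜ.card = l - n := by rw [card_compl, Fintype.card_fin, hG]
  rw [Fintype.card_subtype]
  have hU : (univ.filter fun e : Finset (Fin l) × Finset (Fin l) =>
      e.1 ⊆ G ∧ e.2 ⊆ Gᶜ ∧ e.1.card = e.2.card ∧ 1 ≤ e.1.card ∧ e.1.card ≤ k) =
      (Icc 1 k).biUnion fun j => G.powersetCard j ×ˢ Gᶜ.powersetCard j := by
    ext e
    simp only [mem_filter, mem_univ, true_and, mem_biUnion, mem_Icc, mem_product,
      mem_powersetCard]
    constructor
    · rintro ⟨h1, h2, h3, h4, h5⟩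
      exact ⟨e.1.card, ⟨h4, h5⟩, ⟨h1, rfl⟩, h2, h3.symm⟩
    · rintro ⟨j, ⟨h4, h5⟩, ⟨h1, rfl⟩, h2, h3⟩
      exact ⟨h1, h2, h3.symm, h4, h5⟩
  rw [hU, card_biUnion]
  · simp only [card_product, card_powersetCard, hG, hGc]
  · intro i _ j _ hij
    refine disjoint_left.2 fun e he he' => hij ?_
    rw [mem_product, mem_powersetCard] at he he'
    exact he.1.2.symm.trans he'.1.2

theorem sum_choose_mul_choose_le (n d k : ℕ) :
    ∑ j ∈ Icc 1 k, n.choose j * d.choose j ≤ k * (n ^ k * d ^ k) := by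
  have h : ∀ a : ℕ, ∀ j ∈ Icc 1 k, a.choose j ≤ a ^ k := by
    intro a j hj
    rw [mem_Icc] at hj
    -- a^j ≤ a^k needs a > 0; for a = 0 the binomial vanishes because j ≥ 1.
    rcases Nat.eq_zero_or_pos a with rfl | ha
    · rw [Nat.choose_eq_zero_of_lt (by omega)]
      exact Nat.zero_le _
    · exact (Nat.choose_le_pow _ _).trans (Nat.pow_le_pow_right ha hj.2)
  refine (sum_le_card_nsmul _ _ _ fun j hj => Nat.mul_le_mul (h n j hj) (h d j hj)).trans_eq ?_
  simp

end Representation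

/-! ### Partial derivatives at 0 of a convergent multivariate power series. -/

section Taylor

variable {k : ℕ}

theorem prod_update_pow (x : Fin k → ℂ) (i : Fin k) (t : ℂ) (m : Fin k → ℕ) :
    ∏ j, Function.update x i t j ^ m j = t ^ m i * ∏ j ∈ univ.erase i, x j ^ m j := by
  rw [← mul_prod_erase _ _ (mem_univ i), Function.update_self]
  congr 1
  exact prod_congr rfl fun j hj => by rw [Function.update_of_ne (ne_of_mem_erase hj)]

theorem prod_factorial_add_single (m : Fin k → ℕ) (i : Fin k) :
    ∏ j, (((m + Pi.single i 1 : Fin k → ℕ) j).factorial : ℂ) = (m i + 1) * ∏ j, ((m j).factorial : ℂ) := by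
  rw [← mul_prod_erase _ _ (mem_univ i),
    ← mul_prod_erase univ (fun j => ((m j).factorial : ℂ)) (mem_univ i), ← mul_assoc]
  congr 1
  · simp [Nat.factorial_succ]
  · refine prod_congr rfl fun j hj => ?_
    simp [Pi.single_eq_of_ne (ne_of_mem_erase hj)]

/-- Termwise differentiation of a power series in several variables. -/
theorem hasSum_partialDeriv {d : (Fin k → ℕ) → ℂ} {f : (Fin k → ℂ) → ℂ} {ρ : ℝ}
    (hf : ∀ x : Fin k → ℂ, (∀ i, ‖x i‖ < ρ) →
      HasSum (fun m => d m / (∏ i, ((m i).factorial : ℂ)) * ∏ i, x i ^ m i) (f x))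
    (i : Fin k) (x : Fin k → ℂ) (hx : ∀ i, ‖x i‖ < ρ) :
    HasSum (fun m : Fin k → ℕ => d (m + Pi.single i 1) / (∏ i, ((m i).factorial : ℂ)) * ∏ i, x i ^ m i)
      (partialDeriv i f x) := by
  have hρ : 0 < ρ := (norm_nonneg _).trans_lt (hx i)
  obtain ⟨r, hr, hrρ⟩ := exists_between ((pi_norm_lt_iff hρ).2 hx)
  have hr0 : 0 < r := (norm_nonneg _).trans_lt hr
  have hxr : ∀ j, ‖x j‖ < r := (pi_norm_lt_iff hr0).1 hr
  -- Convergence at the point (r, …, r) supplies the majorant, uniform for |x_i| < r.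
  have hu := (hf (fun _ => (r : ℂ)) fun _ => by
    rwa [Complex.norm_real, Real.norm_of_nonneg hr0.le]).summable.norm
  obtain ⟨F, hF⟩ : ∃ F : (Fin k → ℕ) → ℂ → ℂ, ∀ m t, F m t =
    d m / (∏ i, ((m i).factorial : ℂ)) * ∏ j, Function.update x i t j ^ m j :=
    ⟨_, fun _ _ => rfl⟩
  have hupd : ∀ t ∈ Metric.ball (0 : ℂ) r, ∀ j, ‖Function.update x i t j‖ < r := by
    intro t ht j
    by_cases hj : j = i
    · subst hj
      simpa using ht
    · rw [Function.update_of_ne hj]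
      exact hxr j
  have hderiv : ∀ m t, HasDerivAt (F m) (d m / (∏ i, ((m i).factorial : ℂ)) *
      ((m i : ℂ) * t ^ (m i - 1) * ∏ j ∈ univ.erase i, x j ^ m j)) t := by
    intro m t
    have : F m = fun t => d m / (∏ i, ((m i).factorial : ℂ)) *
        (t ^ m i * ∏ j ∈ univ.erase i, x j ^ m j) := by
      funext t
      rw [hF, prod_update_pow]
    rw [this]
    exact ((hasDerivAt_pow (m i) t).mul_const _).const_mul _
  have hsum := Complex.hasSum_deriv_of_summable_norm (F := F) (z := x i) hu
    (fun m t _ => (hderiv m t).differentiableAt.differentiableWithinAt) Metric.isOpen_ball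
    (fun m t ht => by
      rw [hF, norm_mul, norm_mul, norm_prod, norm_prod]
      refine mul_le_mul_of_nonneg_left ?_ (norm_nonneg _)
      refine prod_le_prod (fun _ _ => norm_nonneg _) fun j _ => ?_
      rw [norm_pow, norm_pow, Complex.norm_real, Real.norm_of_nonneg hr0.le]
      exact pow_le_pow_left₀ (norm_nonneg _) (hupd t ht j).le _)
    (show x i ∈ Metric.ball (0 : ℂ) r by simpa using hxr i)
  have hEq : (fun t => ∑' m, F m t) =ᶠ[nhds (x i)] fun t => f (Function.update x i t) := by
    filter_upwards [Metric.isOpen_ball.mem_nhds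
      (show x i ∈ Metric.ball (0 : ℂ) r by simpa using hxr i)] with t ht
    simp only [hF]
    exact (hf _ fun j => (hupd t ht j).trans hrρ).tsum_eq
  rw [hEq.deriv_eq] at hsum
  -- Differentiation kills the terms with m_i = 0; the others are reindexed by m ↦ m + e_i.
  have hinj : Function.Injective fun m : Fin k → ℕ => m + Pi.single i 1 :=
    fun a b h => add_right_cancel h
  rw [← hinj.hasSum_iff] at hsum
  · refine Eq.subst (motive := fun g => HasSum g _) (funext fun m => ?_) hsum
    rw [Function.comp_apply, (hderiv _ _).deriv, prod_factorial_add_single,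
      ← mul_prod_erase univ (fun j => x j ^ m j) (mem_univ i)]
    have h1 : ∏ j ∈ univ.erase i, x j ^ (m + Pi.single i 1 : Fin k → ℕ) j = ∏ j ∈ univ.erase i, x j ^ m j :=
      prod_congr rfl fun j hj => by simp [Pi.single_eq_of_ne (ne_of_mem_erase hj)]
    have h2 : (m i + 1 : ℂ) ≠ 0 := by exact_mod_cast Nat.succ_ne_zero (m i)
    rw [h1]
    simp only [Pi.add_apply, Pi.single_eq_same, Nat.add_sub_cancel]
    push_cast
    field_simp
  · intro m hm
    rw [(hderiv _ _).deriv]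
    have : m i = 0 := by
      by_contra h0
      refine hm ⟨m - Pi.single i 1, funext fun j => ?_⟩
      by_cases hj : j = i
      · subst hj
        simp only [Pi.add_apply, Pi.sub_apply, Pi.single_eq_same]
        omega
      · simp [Pi.single_eq_of_ne hj]
    simp [this]

/-- With coefficients written as d(m)/m!, ∂_i is the shift of d by e_i and preserves both the form
of the series and the polydisc, so it can be iterated. -/
theorem hasSum_iterate_partialDeriv {d : (Fin k → ℕ) → ℂ} {f : (Fin k → ℂ) → ℂ} {ρ : ℝ}
    (hf : ∀ x : Fin k → ℂ, (∀ i, ‖x i‖ < ρ) →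
      HasSum (fun m => d m / (∏ i, ((m i).factorial : ℂ)) * ∏ i, x i ^ m i) (f x))
    (i : Fin k) (n : ℕ) (x : Fin k → ℂ) (hx : ∀ i, ‖x i‖ < ρ) :
    HasSum (fun m : Fin k → ℕ => d (m + Pi.single i n) / (∏ i, ((m i).factorial : ℂ)) * ∏ i, x i ^ m i)
      ((partialDeriv i)^[n] f x) := by
  induction n generalizing x with
  | zero => simpa using hf x hx
  | succ n ih =>
    rw [Function.iterate_succ_apply']
    generalize (partialDeriv i)^[n] f = g at ih ⊢
    obtain ⟨d', hd'⟩ : ∃ d' : (Fin k → ℕ) → ℂ, ∀ m, d (m + Pi.single i n) = d' m :=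
      ⟨_, fun _ => rfl⟩
    have hstep : ∀ m : Fin k → ℕ, d (m + Pi.single i (n + 1)) = d' (m + Pi.single i 1) := fun m => by
      have h : (Pi.single i (n + 1) : Fin k → ℕ) = Pi.single i 1 + Pi.single i n := by
        rw [Pi.single_add, add_comm]
      rw [← hd', h, add_assoc]
    simp only [hd', hstep] at ih ⊢
    exact hasSum_partialDeriv ih i x hx

/-- The Taylor coefficients of the sum of a power series. -/
theorem taylorCoeff_eq_of_hasSum {d : (Fin k → ℕ) → ℂ} {f : (Fin k → ℂ) → ℂ} {ρ : ℝ} (hρ : 0 < ρ)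
    (hf : ∀ x : Fin k → ℂ, (∀ i, ‖x i‖ < ρ) →
      HasSum (fun m => d m / (∏ i, ((m i).factorial : ℂ)) * ∏ i, x i ^ m i) (f x))
    (m : Fin k → ℕ) : taylorCoeff f m = d m / ∏ i, ((m i).factorial : ℂ) := by
  have key : ∀ (L : List (Fin k)) (x : Fin k → ℂ), (∀ i, ‖x i‖ < ρ) →
      HasSum (fun u => d (u + (L.map fun i => Pi.single i (m i)).sum) /
        (∏ i, ((u i).factorial : ℂ)) * ∏ i, x i ^ u i)
        (L.foldr (fun i g => (partialDeriv i)^[m i] g) f x) := by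
    intro L
    induction L with
    | nil => simpa using hf
    | cons i L ih =>
      intro x hx
      rw [List.map_cons, List.sum_cons, List.foldr_cons]
      generalize L.foldr (fun i g => (partialDeriv i)^[m i] g) f = g at ih ⊢
      obtain ⟨d', hd'⟩ : ∃ d' : (Fin k → ℕ) → ℂ,
          ∀ u, d (u + (L.map fun i => Pi.single i (m i)).sum) = d' u := ⟨_, fun _ => rfl⟩
      simp only [← add_assoc, hd'] at ih ⊢
      exact hasSum_iterate_partialDeriv ih i (m i) x hx
  have h0 := key (List.finRange k) 0 fun i => by simpa using hρ
  have h1 := h0.unique (hasSum_single (0 : Fin k → ℕ) fun u hu => by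
    obtain ⟨i, hi⟩ := Function.ne_iff.1 hu
    have hz : ∏ j, (0 : Fin k → ℂ) j ^ u j = 0 := prod_eq_zero (mem_univ i) (zero_pow hi)
    rw [hz, mul_zero])
  have hsum : ((List.finRange k).map fun i => (Pi.single i (m i) : Fin k → ℕ)).sum = m := by
    rw [← List.ofFn_eq_map, List.sum_ofFn, univ_sum_single]
  rw [taylorCoeff, h1, hsum]
  simp

end Taylor

/-! ### Solving the differential equation for the generating function. -/

section GeneratingFunction

variable {k : ℕ}

/-- The power series of `μ ↦ F(x_1 μ, …, x_k μ^k)`. -/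
noncomputable def seriesF (x : Fin k → ℂ) (μ : ℂ) : ℂ :=
  ∑' m : Fin k → ℕ, coeffF m * (∏ i, x i ^ m i) * μ ^ weight m

/-- The sum `x_2 μ² + x_4 μ⁴ + ⋯`. -/
noncomputable def evenPart (x : Fin k → ℂ) (μ : ℂ) : ℂ :=
  ∑ i ∈ univ.filter (fun i : Fin k => Even ((i : ℕ) + 1)), x i * μ ^ ((i : ℕ) + 1)

/-- The sum `2 x_2 μ + 4 x_4 μ³ + ⋯`. -/
noncomputable def evenDeriv (x : Fin k → ℂ) (μ : ℂ) : ℂ :=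
  ∑ i ∈ univ.filter (fun i : Fin k => Even ((i : ℕ) + 1)),
    (((i : ℕ) + 1 : ℕ) : ℂ) * x i * μ ^ (i : ℕ)

/-- The sum `x_1 + 3 x_3 μ² + ⋯`. -/
noncomputable def oddDeriv (x : Fin k → ℂ) (μ : ℂ) : ℂ :=
  ∑ i ∈ univ.filter (fun i : Fin k => Odd ((i : ℕ) + 1)),
    (((i : ℕ) + 1 : ℕ) : ℂ) * x i * μ ^ (i : ℕ)

theorem hasDerivAt_evenPart (x : Fin k → ℂ) (μ : ℂ) :
    HasDerivAt (evenPart x) (evenDeriv x μ) μ := by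
  unfold evenPart evenDeriv
  refine HasDerivAt.fun_sum fun i _ => ?_
  refine ((hasDerivAt_pow ((i : ℕ) + 1) μ).const_mul (x i)).congr_deriv ?_
  rw [Nat.add_sub_cancel]
  ring

theorem evenDeriv_neg (x : Fin k → ℂ) (μ : ℂ) : evenDeriv x (-μ) = -evenDeriv x μ := by
  unfold evenDeriv
  rw [← sum_neg_distrib]
  refine sum_congr rfl fun i hi => ?_
  have h : Odd (i : ℕ) := by
    have := (mem_filter.1 hi).2
    rw [Nat.even_add_one, Nat.not_even_iff_odd] at this
    exact this
  rw [h.neg_pow, mul_neg]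

theorem oddDeriv_neg (x : Fin k → ℂ) (μ : ℂ) : oddDeriv x (-μ) = oddDeriv x μ := by
  unfold oddDeriv
  refine sum_congr rfl fun i hi => ?_
  have h : Even (i : ℕ) := by
    have := (mem_filter.1 hi).2
    rw [Nat.odd_add_one, Nat.not_odd_iff_even] at this
    exact this
  rw [h.neg_pow]

theorem continuous_evenPart (x : Fin k → ℂ) : Continuous (evenPart x) := by
  unfold evenPart
  fun_prop

theorem continuous_oddDeriv (x : Fin k → ℂ) : Continuous (oddDeriv x) := by
  unfold oddDeriv
  fun_prop

theorem evenPart_zero (x : Fin k → ℂ) : evenPart x 0 = 0 := by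
  simp [evenPart]

theorem seriesF_zero (x : Fin k → ℂ) : seriesF x 0 = 1 := by
  unfold seriesF
  rw [tsum_eq_single 0]
  · simp
  · intro m hm
    rw [zero_pow (fun h => hm (weight_eq_zero_iff.1 h)), mul_zero]

variable {x : Fin k → ℂ} {r : ℝ}

/-- The factor 2^{i+1} in `hx` buys a majorant on |μ| ≤ 2, which puts the evaluation point μ = 1 in
the interior. -/
theorem norm_term_le (hx : ∀ i : Fin k, ‖x i‖ * 2 ^ ((i : ℕ) + 1) ≤ r) {μ : ℂ} (hμ : ‖μ‖ ≤ 2)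
    (m : Fin k → ℕ) :
    ‖coeffF m * (∏ i, x i ^ m i) * μ ^ weight m‖ ≤ ‖coeffF m‖ * r ^ (∑ i, m i) := by
  rw [norm_mul, norm_mul, norm_prod, norm_pow, mul_assoc]
  refine mul_le_mul_of_nonneg_left ?_ (norm_nonneg _)
  rw [weight, ← prod_pow_eq_pow_sum, ← prod_pow_eq_pow_sum, ← prod_mul_distrib]
  refine prod_le_prod (fun _ _ => by positivity) fun i _ => ?_
  rw [norm_pow, pow_mul, ← mul_pow]
  refine pow_le_pow_left₀ (by positivity) (le_trans ?_ (hx i)) _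
  exact mul_le_mul_of_nonneg_left (pow_le_pow_left₀ (norm_nonneg _) hμ _) (norm_nonneg _)

theorem norm_two_mul_evenPart_lt (hkr : k * r ≤ 1 / 4)
    (hx : ∀ i : Fin k, ‖x i‖ * 2 ^ ((i : ℕ) + 1) ≤ r) {μ : ℂ} (hμ : ‖μ‖ ≤ 2) :
    ‖2 * evenPart x μ‖ < 1 := by
  have h : ‖evenPart x μ‖ ≤ k * r := by
    unfold evenPart
    refine (norm_sum_le _ _).trans ?_
    refine (sum_le_sum_of_subset_of_nonneg (filter_subset _ _)
      fun _ _ _ => norm_nonneg _).trans ?_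
    refine (sum_le_sum fun i _ => ?_ : _ ≤ ∑ _i : Fin k, r).trans (by simp)
    rw [norm_mul, norm_pow]
    refine le_trans ?_ (hx i)
    exact mul_le_mul_of_nonneg_left (pow_le_pow_left₀ (norm_nonneg _) hμ _) (norm_nonneg _)
  rw [norm_mul, Complex.norm_two]
  linarith

theorem one_add_evenPart_mem_slitPlane (hkr : k * r ≤ 1 / 4)
    (hx : ∀ i : Fin k, ‖x i‖ * 2 ^ ((i : ℕ) + 1) ≤ r) {μ : ℂ} (hμ : ‖μ‖ ≤ 2) :
    1 + 2 * evenPart x μ ∈ Complex.slitPlane :=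
  Complex.mem_slitPlane_of_norm_lt_one (norm_two_mul_evenPart_lt hkr hx hμ)

theorem summable_norm_term (hr : 0 ≤ r) (hkr : k * r ≤ 1 / 4)
    (hx : ∀ i : Fin k, ‖x i‖ * 2 ^ ((i : ℕ) + 1) ≤ r) {μ : ℂ} (hμ : ‖μ‖ ≤ 2) :
    Summable fun m : Fin k → ℕ => ‖coeffF m * (∏ i, x i ^ m i) * μ ^ weight m‖ :=
  (summable_norm_coeffF hr hkr).of_nonneg_of_le (fun _ => norm_nonneg _)
    (norm_term_le hx hμ)

theorem hasDerivAt_term (x : Fin k → ℂ) (m : Fin k → ℕ) (μ : ℂ) :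
    HasDerivAt (fun μ => coeffF m * (∏ i, x i ^ m i) * μ ^ weight m)
      (coeffF m * (∏ i, x i ^ m i) * ((weight m : ℂ) * μ ^ (weight m - 1))) μ :=
  (hasDerivAt_pow (weight m) μ).const_mul _

theorem hasSum_deriv_seriesF (hr : 0 ≤ r) (hkr : k * r ≤ 1 / 4)
    (hx : ∀ i : Fin k, ‖x i‖ * 2 ^ ((i : ℕ) + 1) ≤ r) {μ : ℂ} (hμ : ‖μ‖ < 2) :
    HasSum (fun m : Fin k → ℕ =>
      coeffF m * (∏ i, x i ^ m i) * ((weight m : ℂ) * μ ^ (weight m - 1)))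
      (deriv (seriesF x) μ) := by
  have h := Complex.hasSum_deriv_of_summable_norm (z := μ)
    (F := fun (m : Fin k → ℕ) μ => coeffF m * (∏ i, x i ^ m i) * μ ^ weight m)
    (summable_norm_coeffF hr hkr)
    (fun m t _ => (hasDerivAt_term x m t).differentiableAt.differentiableWithinAt)
    (Metric.isOpen_ball (x := (0 : ℂ)) (ε := 2))
    (fun m w hw => norm_term_le hx (mem_ball_zero_iff.1 hw).le m) (mem_ball_zero_iff.2 hμ)
  simp only [(hasDerivAt_term x _ μ).deriv] at h
  exact h

theorem hasDerivAt_seriesF (hr : 0 ≤ r) (hkr : k * r ≤ 1 / 4)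
    (hx : ∀ i : Fin k, ‖x i‖ * 2 ^ ((i : ℕ) + 1) ≤ r) {μ : ℂ} (hμ : ‖μ‖ < 2) :
    HasDerivAt (seriesF x) (deriv (seriesF x) μ) μ := by
  have h := Complex.differentiableOn_tsum_of_summable_norm
    (F := fun (m : Fin k → ℕ) μ => coeffF m * (∏ i, x i ^ m i) * μ ^ weight m)
    (summable_norm_coeffF hr hkr)
    (fun m t _ => (hasDerivAt_term x m t).differentiableAt.differentiableWithinAt)
    (Metric.isOpen_ball (x := (0 : ℂ)) (ε := 2))
    (fun m w hw => norm_term_le hx (mem_ball_zero_iff.1 hw).le m)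
  exact (h.differentiableAt (Metric.isOpen_ball.mem_nhds (mem_ball_zero_iff.2 hμ))).hasDerivAt

theorem sum_antidiagonal_term (x : Fin k → ℂ) (μ : ℂ) (m : Fin k → ℕ) :
    ∑ p ∈ antidiagonal m,
      coeffF p.1 * (∏ i, x i ^ p.1 i) * ((weight p.1 : ℂ) * μ ^ (weight p.1 - 1)) *
        (coeffF p.2 * (∏ i, x i ^ p.2 i) * (-μ) ^ weight p.2) =
      if ∑ i, m i = 1 then (weight m : ℂ) * (∏ i, x i ^ m i) * μ ^ (weight m - 1) else 0 := by
  have hrhs : (if ∑ i, m i = 1 then (weight m : ℂ) * (∏ i, x i ^ m i) * μ ^ (weight m - 1)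
      else 0) = (if ∑ i, m i = 1 then (weight m : ℂ) else 0) *
        ((∏ i, x i ^ m i) * μ ^ (weight m - 1)) := by
    split_ifs <;> ring
  rw [hrhs, ← sum_antidiagonal_coeffF, sum_mul]
  refine sum_congr rfl fun p hp => ?_
  rw [HasAntidiagonal.mem_antidiagonal] at hp
  -- The truncated exponent `weight p.1 - 1` is harmless: its term has factor 0 when the weight is
  -- 0.
  by_cases h0 : weight p.1 = 0
  · simp [h0]
  · have hw : weight m - 1 = (weight p.1 - 1) + weight p.2 := by
      rw [← hp, weight_add]
      omega
    have hprod : ∏ i, x i ^ m i = (∏ i, x i ^ p.1 i) * ∏ i, x i ^ p.2 i := by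
      rw [← prod_mul_distrib, ← hp]
      exact prod_congr rfl fun i _ => pow_add _ _ _
    rw [hw, hprod, pow_add, neg_pow μ]
    ring

theorem tsum_ite_sum_eq_one (c : (Fin k → ℕ) → ℂ) :
    ∑' m : Fin k → ℕ, (if ∑ i, m i = 1 then c m else 0) = ∑ i, c (Pi.single i 1) := by
  have hinj : Function.Injective fun i : Fin k => (Pi.single i 1 : Fin k → ℕ) := by
    intro i j hij
    by_contra hne
    have := congrFun hij i
    simp [Pi.single_eq_of_ne hne] at this
  have hsum : ∀ i : Fin k, ∑ j, (Pi.single i 1 : Fin k → ℕ) j = 1 := fun i =>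
    sum_eq_one_iff.2 ⟨i, rfl⟩
  rw [tsum_eq_sum (s := univ.image fun i : Fin k => (Pi.single i 1 : Fin k → ℕ)),
    sum_image fun i _ j _ h => hinj h]
  · exact sum_congr rfl fun i _ => if_pos (hsum i)
  · intro m hm
    rw [if_neg]
    intro h
    obtain ⟨i, rfl⟩ := sum_eq_one_iff.1 h
    exact hm (mem_image_of_mem _ (mem_univ i))

theorem mul_eq_sum_of_antidiagonal {f g c : (Fin k → ℕ) → ℂ} {a b : ℂ} (hf : HasSum f a)
    (hg : HasSum g b) (hfg : ∀ m, ∑ p ∈ antidiagonal m, f p.1 * g p.2 =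
      if ∑ i, m i = 1 then c m else 0) : a * b = ∑ i, c (Pi.single i 1) := by
  rw [← tsum_ite_sum_eq_one, ← hf.tsum_eq, ← hg.tsum_eq,
    hf.summable.tsum_mul_tsum_eq_tsum_sum_antidiagonal hg.summable
      (summable_mul_of_summable_norm hf.summable.norm hg.summable.norm)]
  exact tsum_congr hfg

/-- The differential equation of the generating function. -/
theorem deriv_seriesF_mul_seriesF_neg (hr : 0 ≤ r) (hkr : k * r ≤ 1 / 4)
    (hx : ∀ i : Fin k, ‖x i‖ * 2 ^ ((i : ℕ) + 1) ≤ r) {μ : ℂ} (hμ : ‖μ‖ < 2) :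
    deriv (seriesF x) μ * seriesF x (-μ) = oddDeriv x μ + evenDeriv x μ := by
  have h1 := hasSum_deriv_seriesF hr hkr hx hμ
  have h2 : HasSum (fun m : Fin k → ℕ => coeffF m * (∏ i, x i ^ m i) * (-μ) ^ weight m)
      (seriesF x (-μ)) :=
    (summable_norm_term hr hkr hx (by rw [norm_neg]; exact hμ.le)).of_norm.hasSum
  rw [mul_eq_sum_of_antidiagonal h1 h2 (sum_antidiagonal_term x μ), oddDeriv, evenDeriv,
    ← sum_filter_add_sum_filter_not univ (fun i : Fin k => Odd ((i : ℕ) + 1))]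
  simp only [prod_pow_single, weight_single, Nat.add_sub_cancel, Nat.not_odd_iff_even]

/-- Subtracting the differential equation at -μ from the one at μ cancels the part even in μ, so the
product has derivative 2E'; both sides equal 1 at μ = 0. -/
theorem seriesF_mul_seriesF_neg (hr : 0 ≤ r) (hkr : k * r ≤ 1 / 4)
    (hx : ∀ i : Fin k, ‖x i‖ * 2 ^ ((i : ℕ) + 1) ≤ r) {μ : ℂ} (hμ : ‖μ‖ < 2) :
    seriesF x μ * seriesF x (-μ) = 1 + 2 * evenPart x μ := by
  have hder : ∀ w ∈ Metric.ball (0 : ℂ) 2,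
      HasDerivAt (fun w => seriesF x w * seriesF x (-w) - 2 * evenPart x w) 0 w := by
    intro w hw
    have hw1 : ‖w‖ < 2 := mem_ball_zero_iff.1 hw
    have hw2 : ‖-w‖ < 2 := by rwa [norm_neg]
    have h1 := deriv_seriesF_mul_seriesF_neg hr hkr hx hw1
    have h2 := deriv_seriesF_mul_seriesF_neg hr hkr hx hw2
    rw [neg_neg, oddDeriv_neg, evenDeriv_neg] at h2
    have h3 : HasDerivAt (fun w => seriesF x (-w)) (-deriv (seriesF x) (-w)) w :=
      (HasDerivAt.comp w (hasDerivAt_seriesF hr hkr hx hw2) (hasDerivAt_neg w)).congr_deriv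
        (by ring)
    refine (((hasDerivAt_seriesF hr hkr hx hw1).mul h3).sub
      ((hasDerivAt_evenPart x w).const_mul 2)).congr_deriv ?_
    linear_combination h1 - h2
  have hconst := Metric.isOpen_ball.is_const_of_deriv_eq_zero
    (Metric.isConnected_ball (x := (0 : ℂ)) (r := 2) (by norm_num)).isPreconnected
    (fun w hw => (hder w hw).differentiableAt.differentiableWithinAt)
    (fun w hw => (hder w hw).deriv) (mem_ball_zero_iff.2 hμ)
    (Metric.mem_ball_self (by norm_num : (0 : ℝ) < 2))
  simp only [neg_zero, seriesF_zero, evenPart_zero] at hconst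
  linear_combination hconst

/-- The product identity eliminates A(-μ) and leaves A' = (O + E') A / (1 + 2E). The term E'/(1 +
2E) integrates to half a logarithm, which gives the principal square root; O/(1 + 2E) gives the
exponential of the integral. -/
theorem seriesF_one_eq_ansatzF (hr : 0 ≤ r) (hkr : k * r ≤ 1 / 4)
    (hx : ∀ i : Fin k, ‖x i‖ * 2 ^ ((i : ℕ) + 1) ≤ r) : seriesF x 1 = ansatzF k x := by
  have hslit : ∀ t ∈ Set.Ioo (-2 : ℝ) 2, 1 + 2 * evenPart x t ∈ Complex.slitPlane := by
    intro t ht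
    refine one_add_evenPart_mem_slitPlane hkr hx ?_
    rw [Complex.norm_real]
    exact (abs_lt.2 ⟨ht.1, ht.2⟩).le
  obtain ⟨q, hq⟩ : ∃ q : ℝ → ℂ, q = fun t : ℝ => oddDeriv x t / (1 + 2 * evenPart x t) := ⟨_, rfl⟩
  have hqc : ContinuousOn q (Set.Ioo (-2) 2) := by
    rw [hq]
    refine ContinuousOn.div ?_ ?_ fun t ht => Complex.slitPlane_ne_zero (hslit t ht)
    · exact ((continuous_oddDeriv x).comp Complex.continuous_ofReal).continuousOn
    · exact (continuous_const.add (continuous_const.mul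
        ((continuous_evenPart x).comp Complex.continuous_ofReal))).continuousOn
  -- The expected logarithm of A: it is shown that A e^{-Lg} has derivative 0 on (-2, 2) and so
  -- keeps its value 1 from 0 to 1.
  obtain ⟨Lg, hLg⟩ : ∃ Lg : ℝ → ℂ, Lg = fun t : ℝ =>
    Complex.log (1 + 2 * evenPart x t) * (1 / 2) + ∫ s in (0 : ℝ)..t, q s := ⟨_, rfl⟩
  have hder : ∀ t ∈ Set.Ioo (-2 : ℝ) 2,
      HasDerivAt (fun t : ℝ => seriesF x t * Complex.exp (-Lg t)) 0 t := by
    intro t ht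
    have hμ : ‖(t : ℂ)‖ < 2 := by
      rw [Complex.norm_real]
      exact abs_lt.2 ⟨ht.1, ht.2⟩
    have hne := Complex.slitPlane_ne_zero (hslit t ht)
    have hA := (hasDerivAt_seriesF hr hkr hx hμ).comp_ofReal
    have hE : HasDerivAt (fun t : ℝ => 1 + 2 * evenPart x t) (2 * evenDeriv x t) t :=
      (((hasDerivAt_evenPart x t).const_mul 2).const_add 1).comp_ofReal
    have hI : HasDerivAt (fun t => ∫ s in (0 : ℝ)..t, q s) (q t) t := by
      refine intervalIntegral.integral_hasDerivAt_right ?_ ?_ ?_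
      · refine (hqc.mono ?_).intervalIntegrable
        exact Set.OrdConnected.uIcc_subset Set.ordConnected_Ioo (by norm_num) ht
      · exact hqc.stronglyMeasurableAtFilter isOpen_Ioo t ht
      · exact hqc.continuousAt (isOpen_Ioo.mem_nhds ht)
    have hL : HasDerivAt Lg
        (2 * evenDeriv x t / (1 + 2 * evenPart x t) * (1 / 2) + q t) t := by
      rw [hLg]
      exact ((hE.clog_real (hslit t ht)).mul_const _).add hI
    refine (hA.mul hL.neg.cexp).congr_deriv ?_
    have h1 := deriv_seriesF_mul_seriesF_neg hr hkr hx hμ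
    have h2 := seriesF_mul_seriesF_neg hr hkr hx hμ
    have h3 : deriv (seriesF x) t = (oddDeriv x t + evenDeriv x t) * seriesF x t /
        (1 + 2 * evenPart x t) := by
      rw [eq_div_iff hne, ← h1, ← h2]
      ring
    rw [h3, hq]
    field_simp
    ring
  have hconst := isOpen_Ioo.is_const_of_deriv_eq_zero (isPreconnected_Ioo)
    (fun t ht => (hder t ht).differentiableAt.differentiableWithinAt)
    (fun t ht => (hder t ht).deriv) (show (1 : ℝ) ∈ Set.Ioo (-2 : ℝ) 2 by norm_num)
    (show (0 : ℝ) ∈ Set.Ioo (-2 : ℝ) 2 by norm_num)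
  have hL0 : Lg 0 = 0 := by
    simp [hLg, evenPart_zero]
  simp only [hL0, Complex.ofReal_zero, Complex.ofReal_one, seriesF_zero, neg_zero,
    Complex.exp_zero, mul_one] at hconst
  have hone : seriesF x 1 = Complex.exp (Lg 1) := by
    rw [Complex.exp_neg] at hconst
    field_simp at hconst
    exact hconst
  have hne1 : 1 + 2 * evenPart x 1 ≠ 0 := by
    simpa using Complex.slitPlane_ne_zero (hslit 1 (by norm_num))
  have hev : ∑ i ∈ univ.filter (fun i : Fin k => Even ((i : ℕ) + 1)), x i = evenPart x 1 := by
    simp [evenPart]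
  rw [hone, hLg, hq, ansatzF, hev, Complex.cpow_def_of_ne_zero hne1, ← Complex.exp_add]
  simp only [Complex.ofReal_one]
  rfl

/-- `F` is the generating function of the coefficients `ν`. -/
theorem hasSum_ansatzF (k : ℕ) : ∃ ρ : ℝ, 0 < ρ ∧ ∀ x : Fin k → ℂ, (∀ i, ‖x i‖ < ρ) →
    HasSum (fun m : Fin k → ℕ =>
      (nu m : ℂ) / (∏ i, ((m i).factorial : ℂ)) * ∏ i, x i ^ m i) (ansatzF k x) := by
  -- k + 1 rather than k keeps r well defined for k = 0. The radius r / 2^k below works because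
  -- every exponent i + 1 is at most k.
  obtain ⟨r, hr⟩ : ∃ r : ℝ, r = 1 / (4 * (k + 1)) := ⟨_, rfl⟩
  have hr0 : 0 < r := by rw [hr]; positivity
  have hkr : k * r ≤ 1 / 4 := by
    rw [hr, mul_one_div, div_le_div_iff₀ (by positivity) (by norm_num)]
    linarith
  refine ⟨r / 2 ^ k, by positivity, fun x hx => ?_⟩
  have hx' : ∀ i : Fin k, ‖x i‖ * 2 ^ ((i : ℕ) + 1) ≤ r := fun i => by
    have h1 := (hx i).le
    rw [le_div_iff₀ (by positivity)] at h1
    refine le_trans (mul_le_mul_of_nonneg_left ?_ (norm_nonneg _)) h1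
    exact pow_le_pow_right₀ (by norm_num) i.2
  have hs := summable_norm_term hr0.le hkr hx' (μ := 1) (by norm_num)
  rw [← seriesF_one_eq_ansatzF hr0.le hkr hx', seriesF]
  have := hs.of_norm.hasSum
  simp only [one_pow, mul_one] at this ⊢
  exact this

end GeneratingFunction

end Fermion

open Fermion
theorem theorem3 (l n k : ℕ) (hk : 1 ≤ k) :
    -- `F` is the generating function of the coefficients `ν`
    (∃ ρ : ℝ, 0 < ρ ∧ ∀ x : Fin k → ℂ, (∀ i, ‖x i‖ < ρ) →
      HasSum (fun m : Fin k → ℕ =>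
        (nu m : ℂ) / (∏ i, ((m i).factorial : ℂ)) * ∏ i, x i ^ m i) (ansatzF k x)) ∧
    -- the excitation operators commute and are nilpotent
    (∀ (G : Finset (Fin l)) (θ : Excitation G k → ℂ),
      (∀ i j, Commute (excOp G θ i) (excOp G θ j)) ∧ ∀ i, IsNilpotent (excOp G θ i)) ∧
    -- the representation of the states of `𝒢_k`
    (∀ v ∈ pluckerStates l n k, ∀ G : Finset (Fin l), v G ≠ 0 →
      v = v G • opEval (ansatzF k) (excOp G (theta G k v)) (ket G)) ∧
    -- hence the ansatz covers `𝒢_k`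
    (∀ v ∈ pluckerStates l n k, v ≠ 0 →
      ∃ G : Finset (Fin l), G.card = n ∧ v G ≠ 0 ∧ ∃ θ : Excitation G k → ℂ,
        v = v G • opEval (ansatzF k) (excOp G θ) (ket G)) ∧
    -- and the number of its parameters `θ_{P,Q}` is polynomial
    (∀ G : Finset (Fin l), G.card = n →
      Fintype.card (Excitation G k) =
          ∑ j ∈ Finset.Icc 1 k, n.choose j * (l - n).choose j ∧
        Fintype.card (Excitation G k) ≤ k * (n ^ k * (l - n) ^ k)) := by
  have hcard : ∀ v ∈ pluckerStates l n k, ∀ G : Finset (Fin l), v G ≠ 0 → G.card = n :=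
    fun v hv G hG => by_contra fun h => hG (hv.1 G h)
  have hrep : ∀ v ∈ pluckerStates l n k, ∀ G : Finset (Fin l), v G ≠ 0 →
      v = v G • opEval (ansatzF k) (excOp G (theta G k v)) (ket G) := by
    intro v hv G hG
    obtain ⟨ρ, hρ, hF⟩ := hasSum_ansatzF k
    refine eq_opEval_of_taylorCoeff (fun m => ?_) hG (fun S hS => hv.1 S ?_) hv.2
    · exact taylorCoeff_eq_of_hasSum (d := fun m => (nu m : ℂ)) hρ hF m
    · rwa [← hcard v hv G hG]
  refine ⟨hasSum_ansatzF k, fun G θ => ⟨excOp_commute G θ, excOp_isNilpotent G θ⟩, hrep, ?_, ?_⟩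
  · intro v hv hne
    obtain ⟨G, hG⟩ := Function.ne_iff.1 hne
    exact ⟨G, hcard v hv G hG, hG, theta G k v, hrep v hv G hG⟩
  · intro G hG
    rw [card_excitation hG]
    exact ⟨rfl, sum_choose_mul_choose_le n (l - n) k⟩
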